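/- Let $(W_j)_{j\ge1}$ and $(Z_j)_{j\ge1}$ be two independent sequences, each consisting of i.i.d. real random variables. Let $f(\vartheta)=\log\mathbb E[e^{\vartheta Z_1}]$. Assume: (i) $Z_1$ is not a.s. constant; if $Z_1$ is lattice valued, then the law of $W_1$ has an absolutely continuous part whose density is bounded below by some $p>0$ on some interval $[c,d]$, $c<d$; if $Z_1$ has a density, then $\mathbb P(|W_1|>0)>0$; (ii) $\mathbb E[e^{\vartheta Z_1}]<\infty$ for all $\vartheta\in\mathbb R$; (iii) $f(\vartheta W_1)$ and $W_1f'(\vartheta W_1)$ are integrable for all $\vartheta\in\mathbb R$; (iv) there is $F:\mathbb R\to\mathbb R$ with $\mathbb E[F(W_1)]<\infty$ and, for every $\vartheta\in\mathbb R$, $W_1^2f''(\vartheta W_1)\le F(W_1)$ almost surely. Fix $\vartheta_*>0$ and let $\bar J$ be the closure of $J=(\mathbb E[W_1]\mathbb E[Z_1],\ \mathbb E[W_1f'(\vartheta_*W_1)])$. Put $g(\vartheta)=\mathbb E[f(W_1\vartheta)]$, let $\vartheta(a)$ be the solution of $g'(\vartheta)=a$, let $I(a)=a\vartheta(a)-g(\vartheta(a))$,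 and $$X_n(\vartheta)=\frac1{\sqrt n}\sum_{j=1}^n\bigl(f(W_j\vartheta)-\mathbb E[f(W_j\vartheta)]\bigr),$$ with $X_n',X_n''$ its derivatives in $\vartheta$. Let $\vartheta_n^{\mathcal W}(a)$ be the solution of $\frac1n\sum_{j=1}^nW_jf'(W_j\vartheta)=a$ and $I_n^{\mathcal W}(a)=a\vartheta_n^{\mathcal W}(a)-\frac1n\sum_{j=1}^nf(W_j\vartheta_n^{\mathcal W}(a))$. Assume that $g''(\vartheta(a))>c$ for all $a\in\bar J$, for some constant $c>0$, and that there is $C<\infty$ such that for all $a,a'\in\bar J$ the variables $Y_k(a)=W_1^kf^{(k)}(\vartheta(a)W_1)$, $k=0,1,2,3$, are square integrable, $\operatorname{Cov}(Y_k(a),Y_l(a'))<C$ for $0\le k\le l\le 2$, and $\operatorname{Var}(Y_3(a))<C$. Then for every $a\in\bar J$ the point $\vartheta(a)$ exists and is unique; almost surely, for all $n$ large enough, $\vartheta_n^{\mathcal W}(a)$ exists and is unique for all $a\in\bar J$; and $$I_n^{\mathcal W}(a)=I(a)-n^{-1/2}X_n(\vartheta(a))+n^{-1}r_n(a),\qquad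 a\in\bar J,$$ where $$r_n(a)=\frac{(X_n'(\vartheta(a)))^2}{2\left[g''(\vartheta(a))+n^{-1/2}X_n''(\vartheta(a))\right]}+o(1)$$ with an error $o(1)$ that converges to $0$ in probability, uniformly in $a\in\bar J$ (that is, for every $\varepsilon>0$ the probability that it exceeds $\varepsilon$ in absolute value for some $a\in\bar J$ tends to $0$). Moreover, the processes $(X_n(\vartheta(a)))_{a\in\bar J}$ have continuous paths and converge in distribution, as random elements of $C(\bar J,\mathbb R)$, to a centered Gaussian process $(X_a)_{a\in\bar J}$ with continuous paths and $$\operatorname{Cov}(X_a,X_{a'})=\mathbb E[f(W_1\vartheta(a))f(W_1\vartheta(a'))]-\mathbb E[f(W_1\vartheta(a))]\,\mathbb E[f(W_1\vartheta(a'))].$$ -/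

import Mathlib

open MeasureTheory ProbabilityTheory Filter Topology

/-- The Borel σ-algebra on the space of continuous functions (compact-open topology, i.e. the
topology of uniform convergence when `K` is compact). -/
instance instMeasurableSpaceContinuousReal {K : Type*} [TopologicalSpace K] :
    MeasurableSpace C(K, ℝ) := borel _

instance instBorelSpaceContinuousReal {K : Type*} [TopologicalSpace K] :
    BorelSpace C(K, ℝ) := ⟨rfl⟩

namespace RandomRate

noncomputable section

variable {Ω : Type*} [MeasurableSpace Ω]

/-- `(W j)` is i.i.d., `(Z j)` is i.i.d., and the σ-fields generated by the two sequences are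
independent. The sequences are indexed from `0`, so `W 0`, `Z 0` are the first variables. -/
structure IsModel (W Z : ℕ → Ω → ℝ) (μ : Measure Ω) : Prop where
  measurable_W : ∀ j, Measurable (W j)
  measurable_Z : ∀ j, Measurable (Z j)
  indep_W : iIndepFun W μ
  indep_Z : iIndepFun Z μ
  ident_W : ∀ j, IdentDistrib (W j) (W 0) μ μ
  ident_Z : ∀ j, IdentDistrib (Z j) (Z 0) μ μ
  indep_WZ : IndepFun (fun ω j => Z j ω) (fun ω j => W j ω) μ

/-- `Z` takes values in a lattice `b + h ℤ`, `h > 0`, almost surely. -/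
def IsLatticeValued (Z : Ω → ℝ) (μ : Measure Ω) : Prop :=
  ∃ b h : ℝ, 0 < h ∧ ∀ᵐ ω ∂μ, ∃ k : ℤ, Z ω = b + k * h

/-- The law of `Z` has a density with respect to Lebesgue measure. -/
def HasLebesgueDensity (Z : Ω → ℝ) (μ : Measure Ω) : Prop :=
  μ.map Z ≪ volume

/-- The density of the absolutely continuous part of the law of `W` is bounded below by some
`p > 0` on some nondegenerate interval `[c, d]`. -/
def HasDensityBoundedBelow (W : Ω → ℝ) (μ : Measure Ω) : Prop :=
  ∃ c d p : ℝ, c < d ∧ 0 < p ∧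
    ∀ᵐ x ∂(volume.restrict (Set.Icc c d)), ENNReal.ofReal p ≤ (μ.map W).rnDeriv volume x

/-- Standing conditions on `W = W₁`, `Z = Z₁`; here `f = log E[exp(· Z)]` is `cgf Z μ`. -/
structure LDConditions (W Z : Ω → ℝ) (μ : Measure Ω) : Prop where
  nondegenerate : ¬ ∃ b : ℝ, ∀ᵐ ω ∂μ, Z ω = b
  of_lattice : IsLatticeValued Z μ → HasDensityBoundedBelow W μ
  of_density : HasLebesgueDensity Z μ → 0 < μ {ω | 0 < |W ω|}
  mgf_finite : ∀ θ : ℝ, Integrable (fun ω => Real.exp (θ * Z ω)) μ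
  integrable_f : ∀ θ : ℝ, Integrable (fun ω => cgf Z μ (θ * W ω)) μ
  integrable_f' : ∀ θ : ℝ, Integrable (fun ω => W ω * deriv (cgf Z μ) (θ * W ω)) μ
  majorant : ∃ F : ℝ → ℝ, Integrable (fun ω => F (W ω)) μ ∧
    ∀ θ : ℝ, ∀ᵐ ω ∂μ, (W ω) ^ 2 * iteratedDeriv 2 (cgf Z μ) (θ * W ω) ≤ F (W ω)

/-- `g(θ) = E[f(W₁ θ)]`. -/
def g (W Z : ℕ → Ω → ℝ) (μ : Measure Ω) (θ : ℝ) : ℝ :=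
  ∫ ω, cgf (Z 0) μ (W 0 ω * θ) ∂μ

/-- The solution `ϑ(a)` of `g'(ϑ) = a`. -/
def saddle (W Z : ℕ → Ω → ℝ) (μ : Measure Ω) (a : ℝ) : ℝ :=
  Classical.epsilon fun θ : ℝ => deriv (g W Z μ) θ = a

/-- `I(a) = a ϑ(a) - g(ϑ(a))`. -/
def rate (W Z : ℕ → Ω → ℝ) (μ : Measure Ω) (a : ℝ) : ℝ :=
  a * saddle W Z μ a - g W Z μ (saddle W Z μ a)

/-- `Ψ_n(θ) = (1/n) ∑_{j ≤ n} f(W_j θ)`. -/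
def empPsi (W Z : ℕ → Ω → ℝ) (μ : Measure Ω) (n : ℕ) (ω : Ω) (θ : ℝ) : ℝ :=
  (1 / (n : ℝ)) * ∑ j ∈ Finset.range n, cgf (Z 0) μ (W j ω * θ)

/-- The random solution `ϑ_n(a)` of `Ψ_n'(ϑ) = a`. -/
def empSaddle (W Z : ℕ → Ω → ℝ) (μ : Measure Ω) (n : ℕ) (ω : Ω) (a : ℝ) : ℝ :=
  Classical.epsilon fun θ : ℝ => deriv (empPsi W Z μ n ω) θ = a

/-- The random rate function `I_n(a) = a ϑ_n(a) - (1/n) ∑_{j ≤ n} f(W_j ϑ_n(a))`. -/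
def empRate (W Z : ℕ → Ω → ℝ) (μ : Measure Ω) (n : ℕ) (ω : Ω) (a : ℝ) : ℝ :=
  a * empSaddle W Z μ n ω a - empPsi W Z μ n ω (empSaddle W Z μ n ω a)

/-- `X_n(θ) = n^{-1/2} ∑_{j ≤ n} (f(W_j θ) - E[f(W_j θ)])`. -/
def X (W Z : ℕ → Ω → ℝ) (μ : Measure Ω) (n : ℕ) (ω : Ω) (θ : ℝ) : ℝ :=
  (1 / √(n : ℝ)) * ∑ j ∈ Finset.range n,
    (cgf (Z 0) μ (W j ω * θ) - ∫ ω', cgf (Z 0) μ (W j ω' * θ) ∂μ)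

/-- The closure of `J = (E[W₁] E[Z₁], E[W₁ f'(ϑ⋆ W₁)])`. -/
def Jbar (W Z : ℕ → Ω → ℝ) (μ : Measure Ω) (θs : ℝ) : Set ℝ :=
  closure (Set.Ioo ((∫ ω, W 0 ω ∂μ) * ∫ ω, Z 0 ω ∂μ)
    (∫ ω, W 0 ω * deriv (cgf (Z 0) μ) (θs * W 0 ω) ∂μ))

/-- The variables `W₁^k f^{(k)}(ϑ(a) W₁)`. -/
def Y (W Z : ℕ → Ω → ℝ) (μ : Measure Ω) (k : ℕ) (a : ℝ) (ω : Ω) : ℝ :=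
  (W 0 ω) ^ k * iteratedDeriv k (cgf (Z 0) μ) (saddle W Z μ a * W 0 ω)

/-- The covariances of `f(ϑ(a)W)`, `W f'(ϑ(a)W)`, `W² f''(ϑ(a)W)` at `a, a' ∈ J̄`, and the
variance of `W³ f'''(ϑ(a)W)`, exist and are bounded by one constant. -/
structure CovAssumption (W Z : ℕ → Ω → ℝ) (μ : Measure Ω) (θs : ℝ) : Prop where
  memLp : ∀ a ∈ Jbar W Z μ θs, ∀ k ≤ 3, MemLp (Y W Z μ k a) 2 μ
  bound : ∃ C : ℝ, ∀ a ∈ Jbar W Z μ θs, ∀ a' ∈ Jbar W Z μ θs,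
    cov[Y W Z μ 0 a, Y W Z μ 0 a'; μ] < C ∧
    cov[Y W Z μ 1 a, Y W Z μ 1 a'; μ] < C ∧
    cov[Y W Z μ 2 a, Y W Z μ 2 a'; μ] < C ∧
    cov[Y W Z μ 0 a, Y W Z μ 1 a'; μ] < C ∧
    cov[Y W Z μ 1 a, Y W Z μ 2 a'; μ] < C ∧
    cov[Y W Z μ 0 a, Y W Z μ 2 a'; μ] < C ∧
    Var[Y W Z μ 3 a; μ] < C

end

end RandomRate

/-! Write `f` for the cumulant generating function of `Z 0` and θ for ϑ(a). The empirical rate is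
the Legendre transform at slope a of the convex function Ψ_n(t) = (1/n) ∑ f(W_j t), so it can be
expanded around the deterministic point θ, where Ψ_n'(θ) = a + n^{-1/2} X_n'(θ). Near θ the function
Ψ_n is squeezed between two parabolas of curvature Ψ_n''(θ) ± 2η, where η bounds the oscillation of
Ψ_n''. This gives aθ - Ψ_n(θ) + (a - Ψ_n'(θ))²/(2Ψ_n''(θ)) up to an error 2η(a - Ψ_n'(θ))²/m², with
m a lower bound for Ψ_n''(θ) (`abs_legendre_expansion_le`). After multiplication by n the error is
2η X_n'(θ)²/m², so three facts, uniform in a, suffice: X_n' is bounded in probability on [0, θs], η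
can be made small, and m stays fixed.

The last two come from the law of large numbers for single functions of w that minorize w² f''(wθ),
or dominate its oscillation, for all bounded θ at once (`exists_minorant_deriv2`,
`exists_modulus_deriv2`). They rest on two readings of the majorant F: at one nonzero value of `W 0`
it bounds f'' on the whole line, and at θ = 0 it makes `W 0` square integrable. The bound on X_n'
comes from writing it as X_n'(0) plus an integral of X_n'', whose variance is controlled at each
fixed point (`exists_bound_fluct_deriv`).

The same bound makes the paths Lipschitz in ϑ(a) with high probability, hence their laws tight by
Arzelà–Ascoli. Finite combinations of evaluations are normalized i.i.d. sums, so the ordinary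
central limit theorem identifies every cluster point, and Prokhorov's theorem gives convergence
(`exists_isGaussianProcess_tendstoInDistribution`). If `W 0` vanishes almost surely, J̄ is empty. -/

/-! ### Quadratic expansion of a Legendre transform. -/

section Legendre

/-- Second order Taylor bound when the second derivative oscillates by at most `η`. -/
lemma abs_sub_taylor_two_le {Ψ Ψ₁ Ψ₂ : ℝ → ℝ} (h₁ : ∀ x, HasDerivAt Ψ (Ψ₁ x) x)
    (h₂ : ∀ x, HasDerivAt Ψ₁ (Ψ₂ x) x) {θ δ η : ℝ}
    (hη : ∀ t, |t - θ| ≤ δ → |Ψ₂ t - Ψ₂ θ| ≤ η) {t : ℝ} (ht : |t - θ| ≤ δ) :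
    |Ψ₁ t - Ψ₁ θ - Ψ₂ θ * (t - θ)| ≤ η * |t - θ| ∧
      |Ψ t - Ψ θ - Ψ₁ θ * (t - θ) - Ψ₂ θ / 2 * (t - θ) ^ 2| ≤ η * (t - θ) ^ 2 := by
  -- The remainder of Ψ₁ vanishes at θ and has derivative `Ψ₂ x - Ψ₂ θ`, so the mean value
  -- inequality applies. A second use, on the ball of radius `|t - θ|`, integrates this bound; the
  -- factor 1/2 lost there is harmless.
  have key : ∀ s, |s - θ| ≤ δ → |Ψ₁ s - Ψ₁ θ - Ψ₂ θ * (s - θ)| ≤ η * |s - θ| := by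
    intro s hs
    have hd : ∀ x ∈ Metric.closedBall θ δ, HasDerivWithinAt
        (fun x => Ψ₁ x - Ψ₁ θ - Ψ₂ θ * (x - θ)) (Ψ₂ x - Ψ₂ θ) (Metric.closedBall θ δ) x := by
      intro x _
      have := (((h₂ x).sub_const (Ψ₁ θ)).sub
        (((hasDerivAt_id x).sub_const θ).const_mul (Ψ₂ θ))).hasDerivWithinAt
        (s := Metric.closedBall θ δ)
      convert! this using 1
      simp
    have hs' : s ∈ Metric.closedBall θ δ := by simpa [Real.dist_eq] using hs
    have hθ : θ ∈ Metric.closedBall θ δ := by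
      simpa using (abs_nonneg _).trans hs
    have := (convex_closedBall θ δ).norm_image_sub_le_of_norm_hasDerivWithin_le hd
      (fun x hx => by simpa [Real.norm_eq_abs] using hη x (by simpa [Real.dist_eq] using hx))
      hθ hs'
    simpa [Real.norm_eq_abs] using this
  refine ⟨key t ht, ?_⟩
  have hd : ∀ x ∈ Metric.closedBall θ |t - θ|, HasDerivWithinAt
      (fun x => Ψ x - Ψ θ - Ψ₁ θ * (x - θ) - Ψ₂ θ / 2 * (x - θ) ^ 2)
      (Ψ₁ x - Ψ₁ θ - Ψ₂ θ * (x - θ)) (Metric.closedBall θ |t - θ|) x := by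
    intro x _
    have := ((((h₁ x).sub_const (Ψ θ)).sub
      (((hasDerivAt_id x).sub_const θ).const_mul (Ψ₁ θ))).sub
      ((((hasDerivAt_id x).sub_const θ).pow 2).const_mul (Ψ₂ θ / 2))).hasDerivWithinAt
        (s := Metric.closedBall θ |t - θ|)
    convert! this using 1
    simp; ring
  have hη0 : 0 ≤ η := (abs_nonneg _).trans (hη t ht)
  have := (convex_closedBall θ |t - θ|).norm_image_sub_le_of_norm_hasDerivWithin_le hd
      (C := η * |t - θ|) (fun x hx => by
        have hx' : |x - θ| ≤ |t - θ| := by simpa [Real.dist_eq] using hx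
        exact (key x (hx'.trans ht)).trans (by gcongr))
      (Metric.mem_closedBall_self (abs_nonneg _)) (y := t) (by simp [Real.dist_eq])
  simp only [Real.norm_eq_abs, sub_self, mul_zero, zero_pow two_ne_zero, sub_zero] at this
  rwa [mul_assoc, abs_mul_abs_self, ← sq] at this

/-- Expansion of the Legendre transform of a convex function `Ψ` around a point `θ` where
`Ψ'` nearly attains the slope `a`. -/
lemma abs_legendre_expansion_le {Ψ Ψ₁ Ψ₂ : ℝ → ℝ} (h₁ : ∀ x, HasDerivAt Ψ (Ψ₁ x) x)
    (h₂ : ∀ x, HasDerivAt Ψ₁ (Ψ₂ x) x) (hmono : StrictMono Ψ₁) {θ δ η m a t : ℝ}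
    (hδ : 0 < δ) (hm : 0 < m) (hηm : 4 * η ≤ m)
    (hη : ∀ t, |t - θ| ≤ δ → |Ψ₂ t - Ψ₂ θ| ≤ η) (hlow : m ≤ Ψ₂ θ)
    (hb : 2 * |a - Ψ₁ θ| ≤ m * δ) (ht : Ψ₁ t = a) :
    |a * t - Ψ t - (a * θ - Ψ θ) - (a - Ψ₁ θ) ^ 2 / (2 * Ψ₂ θ)|
      ≤ 2 * η * (a - Ψ₁ θ) ^ 2 / m ^ 2 := by
  have hη0 : 0 ≤ η := (abs_nonneg _).trans (hη θ (by simpa using hδ.le))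
  set D := Ψ₂ θ with hD
  set b := a - Ψ₁ θ with hbdef
  have hDpos : 0 < D := hm.trans_le hlow
  -- the maximiser lies in the `δ`-neighbourhood
  have htδ : |t - θ| ≤ δ := by
    have hp := (abs_le.1 (abs_sub_taylor_two_le h₁ h₂ hη (t := θ + δ) (by simp [abs_of_pos hδ])).1).1
    have hn := (abs_le.1 (abs_sub_taylor_two_le h₁ h₂ hη (t := θ - δ) (by simp [abs_of_pos hδ])).1).2
    simp only [add_sub_cancel_left, sub_sub_cancel_left, abs_neg, abs_of_pos hδ] at hp hn
    have hbb := abs_le.1 (le_refl |b|)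
    have h3 : m * δ ≤ D * δ := by gcongr
    have h4 : 4 * η * δ ≤ m * δ := by gcongr
    have hup : a ≤ Ψ₁ (θ + δ) := by nlinarith
    have hdn : Ψ₁ (θ - δ) ≤ a := by nlinarith
    rw [← ht] at hup hdn
    rw [abs_le]
    constructor
    · linarith [hmono.le_iff_le.1 hdn]
    · linarith [hmono.le_iff_le.1 hup]
  -- tangent line at `t`
  have hconv : ConvexOn ℝ Set.univ Ψ := by
    apply MonotoneOn.convexOn_of_deriv convex_univ
      (continuous_iff_continuousAt.2 fun x => (h₁ x).continuousAt).continuousOn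
      (fun x _ => (h₁ x).differentiableAt.differentiableWithinAt)
    rw [show deriv Ψ = Ψ₁ from funext fun x => (h₁ x).deriv]
    exact hmono.monotone.monotoneOn _
  have htan : ∀ s, a * s - Ψ s ≤ a * t - Ψ t := by
    intro s
    rcases lt_trichotomy s t with h | h | h
    · have := hconv.slope_le_of_hasDerivAt (Set.mem_univ s) (Set.mem_univ t) h (h₁ t)
      rw [slope_def_field, div_le_iff₀ (by linarith), ht] at this
      linarith
    · rw [h]
    · have := hconv.le_slope_of_hasDerivAt (Set.mem_univ t) (Set.mem_univ s) h (h₁ t)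
      rw [slope_def_field, le_div_iff₀ (by linarith), ht] at this
      linarith
  have hD2 : 0 < D + 2 * η := by linarith
  have hD3 : 0 < D - 2 * η := by linarith
  have hsplit : ∀ s, a * s - Ψ s - (a * θ - Ψ θ)
      = b * (s - θ) - (Ψ s - Ψ θ - Ψ₁ θ * (s - θ)) := by intro s; rw [hbdef]; ring
  -- lower bound
  set s := θ + b / (D + 2 * η) with hs
  have hsδ : |s - θ| ≤ δ := by
    rw [hs, add_sub_cancel_left, abs_div, abs_of_pos hD2, div_le_iff₀ hD2]
    nlinarith [abs_nonneg b]
  have hL := (abs_le.1 (abs_sub_taylor_two_le h₁ h₂ hη hsδ).2).2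
  have hU := (abs_le.1 (abs_sub_taylor_two_le h₁ h₂ hη htδ).2).1
  -- The point s maximizes the minorizing parabola of curvature `D + 2η`, and t does at least as
  -- well as s by `htan`.
  have hlower : b ^ 2 / (2 * (D + 2 * η)) ≤ a * t - Ψ t - (a * θ - Ψ θ) := by
    refine le_trans ?_ (sub_le_sub_right (htan s) _)
    rw [hsplit]
    have e : s - θ = b / (D + 2 * η) := by rw [hs]; ring
    have e2 : b ^ 2 / (2 * (D + 2 * η)) = b * (s - θ) - (D + 2 * η) / 2 * (s - θ) ^ 2 := by
      rw [e]; field_simp; ring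
    rw [e2]
    linarith
  -- The value at t is at most that of the parabola of curvature `D - 2η`, whose maximum is found by
  -- completing the square.
  have hupper : a * t - Ψ t - (a * θ - Ψ θ) ≤ b ^ 2 / (2 * (D - 2 * η)) := by
    rw [hsplit, le_div_iff₀ (by positivity)]
    have : b * (t - θ) - (Ψ t - Ψ θ - Ψ₁ θ * (t - θ)) ≤
      b * (t - θ) - (D - 2 * η) / 2 * (t - θ) ^ 2 := by linarith
    nlinarith [sq_nonneg (b - (D - 2 * η) * (t - θ)), mul_le_mul_of_nonneg_right this
      (show 0 ≤ 2 * (D - 2 * η) by linarith)]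
  -- From 4η ≤ m ≤ D one gets D - 2η ≥ D/2, so both denominators can be replaced by m².
  have hm2 : m ^ 2 ≤ D * (D + 2 * η) := by nlinarith
  have hm3 : m ^ 2 ≤ 2 * (D * (D - 2 * η)) := by nlinarith
  rw [abs_le]
  constructor
  · have : b ^ 2 / (2 * (D + 2 * η)) - b ^ 2 / (2 * D) = - (η * b ^ 2 / (D * (D + 2 * η))) := by
      field_simp; ring
    have h5 : η * b ^ 2 / (D * (D + 2 * η)) ≤ η * b ^ 2 / m ^ 2 := by gcongr
    have h6 : 0 ≤ η * b ^ 2 / m ^ 2 := by positivity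
    have h7 : 2 * η * b ^ 2 / m ^ 2 = 2 * (η * b ^ 2 / m ^ 2) := by ring
    linarith
  · have : b ^ 2 / (2 * (D - 2 * η)) - b ^ 2 / (2 * D)
        = 2 * η * b ^ 2 / (2 * (D * (D - 2 * η))) := by
      field_simp; ring
    have h5 : 2 * η * b ^ 2 / (2 * (D * (D - 2 * η))) ≤ 2 * η * b ^ 2 / m ^ 2 := by gcongr
    linarith

end Legendre

/-! ### Tightness and Gaussian limits in `C(K, ℝ)`. -/

section GaussianLimit

variable {Ω : Type*} [MeasurableSpace Ω] {μ : Measure Ω}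
  {K : Type*} [TopologicalSpace K]

/-- The continuous linear form `x ↦ ∑ a, w a * x a` on `C(K, ℝ)`. -/
noncomputable def evalComb (w : K →₀ ℝ) : C(K, ℝ) →L[ℝ] ℝ :=
  w.sum fun a c => c • ContinuousMap.evalCLM ℝ a

lemma evalComb_apply (w : K →₀ ℝ) (x : C(K, ℝ)) :
    evalComb w x = w.sum fun a c => c * x a := by
  simp [evalComb, Finsupp.sum]

@[simp]
lemma evalComb_single (a : K) (c : ℝ) (x : C(K, ℝ)) :
    evalComb (Finsupp.single a c) x = c * x a := by
  rw [evalComb_apply, Finsupp.sum_single_index (by simp)]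

lemma evalComb_add (w w' : K →₀ ℝ) (x : C(K, ℝ)) :
    evalComb (w + w') x = evalComb w x + evalComb w' x := by
  simp only [evalComb_apply]
  exact Finsupp.sum_add_index' (by simp) (by intros; ring)

lemma evalComb_smul (r : ℝ) (w : K →₀ ℝ) (x : C(K, ℝ)) :
    evalComb (r • w) x = r * evalComb w x := by
  simp only [evalComb_apply]
  rw [Finsupp.sum_smul_index (by simp), Finsupp.sum, Finsupp.sum, Finset.mul_sum]
  simp [mul_assoc]

/-- Laws on `C(K, ℝ)` are tight if the paths are, with high probability, bounded at a point and
Lipschitz with respect to a continuous pseudo-distance `|σ a - σ b|`. -/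
lemma isTightMeasureSet_range_map_of_lipschitz {ι : Type*} {Y : ι → Ω → C(K, ℝ)}
    (hY : ∀ i, Measurable (Y i)) {σ : K → ℝ} (hσ : Continuous σ) (a₀ : K)
    (hbd : ∀ ε : ENNReal, 0 < ε → ∃ R : ℝ, ∀ i,
      μ {ω | ¬ (|Y i ω a₀| ≤ R ∧ ∀ a b, |Y i ω a - Y i ω b| ≤ R * |σ a - σ b|)} ≤ ε) :
    IsTightMeasureSet (Set.range fun i => μ.map (Y i)) := by
  rw [isTightMeasureSet_iff_exists_isCompact_measure_compl_le]
  intro ε hε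
  obtain ⟨R, hR⟩ := hbd ε hε
  set S : Set C(K, ℝ) := {x | |x a₀| ≤ R ∧ ∀ a b, |x a - x b| ≤ R * |σ a - σ b|} with hS
  have hSK : IsCompact S := by
    apply ArzelaAscoli.isCompact_of_equicontinuous
    -- The Lipschitz inequality in σ already forces continuity, so the image of S in the product
    -- space is cut out by closed conditions alone and sits inside a product of compact intervals.
    · let T : Set (K → ℝ) := {x | |x a₀| ≤ R ∧ ∀ a b, |x a - x b| ≤ R * |σ a - σ b|}
      have himg : ContinuousMap.toFun '' S = T := by
        ext x
        constructor
        · rintro ⟨y, hy, rfl⟩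
          exact hy
        · intro hx
          refine ⟨⟨x, ?_⟩, hx, rfl⟩
          rw [continuous_iff_continuousAt]
          intro a
          rw [ContinuousAt, tendsto_iff_dist_tendsto_zero]
          refine squeeze_zero (fun _ => dist_nonneg) (fun b => hx.2 b a) ?_
          have : Continuous fun b => R * |σ b - σ a| := by fun_prop
          simpa using this.tendsto a
      rw [himg]
      have hTc : IsClosed T := by
        have h1 : IsClosed {x : K → ℝ | |x a₀| ≤ R} := isClosed_le (by fun_prop) continuous_const
        have h2 : IsClosed {x : K → ℝ | ∀ a b, |x a - x b| ≤ R * |σ a - σ b|} := by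
          simp only [Set.ofPred_forall]
          exact isClosed_iInter fun a => isClosed_iInter fun b =>
            isClosed_le (by fun_prop) continuous_const
        exact h1.inter h2
      refine (isCompact_univ_pi (s := fun a => Set.Icc (-(R + R * |σ a - σ a₀|))
        (R + R * |σ a - σ a₀|)) fun a => isCompact_Icc).of_isClosed_subset hTc ?_
      rintro x ⟨hx1, hx2⟩ a -
      rw [Set.mem_Icc, ← abs_le]
      calc |x a| = |x a₀ + (x a - x a₀)| := by ring_nf
        _ ≤ |x a₀| + |x a - x a₀| := abs_add_le _ _
        _ ≤ _ := add_le_add hx1 (hx2 _ _)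
    · intro a
      rw [Metric.equicontinuousAt_iff_right]
      intro r hr
      have hc : Continuous fun b => R * |σ a - σ b| := by fun_prop
      have : ∀ᶠ b in 𝓝 a, R * |σ a - σ b| < r :=
        (hc.tendsto a).eventually_lt_const (by simpa using hr)
      filter_upwards [this] with b hb x
      exact (x.2.2 a b).trans_lt hb
  refine ⟨S, hSK, ?_⟩
  rintro _ ⟨i, rfl⟩
  rw [Measure.map_apply (hY i) hSK.isClosed.measurableSet.compl]
  exact hR i

variable [IsProbabilityMeasure μ] [CompactSpace K] [SecondCountableTopology K]

/-- A finite measure on `C(K, ℝ)` is determined by the laws of finite combinations of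
evaluations. -/
lemma ContinuousMap.measure_ext_of_evalComb {P P' : Measure C(K, ℝ)} [IsFiniteMeasure P]
    [IsFiniteMeasure P'] [T2Space K] (h : ∀ w : K →₀ ℝ, P.map (evalComb w) = P'.map (evalComb w)) :
    P = P' := by
  -- With the discrete topology on the weights, joint continuity of the pairing reduces to
  -- continuity of each `evalComb w`. The pairing separates points through single evaluations, so
  -- characteristic functions along it determine the measure.
  let _ : TopologicalSpace (K →₀ ℝ) := ⊥
  have : DiscreteTopology (K →₀ ℝ) := ⟨rfl⟩
  let L : C(K, ℝ) →ₗ[ℝ] (K →₀ ℝ) →ₗ[ℝ] ℝ := LinearMap.mk₂ ℝ (fun x w => evalComb w x)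
    (fun x x' w => map_add _ _ _) (fun c x w => map_smul _ _ _)
    (fun x w w' => evalComb_add w w' x) (fun c x w => evalComb_smul c w x)
  have hL : Continuous fun p : C(K, ℝ) × (K →₀ ℝ) => L p.1 p.2 := by
    rw [continuous_prod_of_discrete_right]
    exact fun w => (evalComb w).continuous
  refine ext_of_integral_char_eq (L := L) Real.continuous_probChar
    Real.probChar_ne_one ?_ hL ?_
  · intro v hv h0
    apply hv
    ext a
    have := congrArg (fun l => l (Finsupp.single a 1)) h0
    simpa [L] using this
  · intro w
    have key (Q : Measure C(K, ℝ)) [IsFiniteMeasure Q] :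
        ∫ v, BoundedContinuousFunction.char Real.continuous_probChar hL w v ∂Q
          = ∫ y, ((Real.probChar y : Circle) : ℂ) ∂(Q.map (evalComb w)) := by
      rw [integral_map (evalComb w).continuous.aemeasurable]
      · rfl
      · exact (continuous_subtype_val.comp
          Real.continuous_probChar).aestronglyMeasurable
    rw [key P, key P', h w]

variable [T2Space K]

/-- A tight sequence of random continuous functions whose finite combinations of evaluations
satisfy a central limit theorem converges in distribution to a Gaussian process. -/
theorem exists_isGaussianProcess_tendstoInDistribution {Y : ℕ → Ω → C(K, ℝ)}
    (hY : ∀ n, Measurable (Y n)) (htight : IsTightMeasureSet (Set.range fun n => μ.map (Y n)))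
    {φ : K → Ω → ℝ} (hφ : ∀ a, MemLp (φ a) 2 μ)
    (hclt : ∀ w : K →₀ ℝ, TendstoInDistribution (fun n ω => evalComb w (Y n ω)) atTop id
      (fun _ => μ) (gaussianReal 0 (Var[fun ω => w.sum fun a c => c * φ a ω; μ]).toNNReal)) :
    ∃ (P : Measure C(K, ℝ)) (_ : IsProbabilityMeasure P),
      IsGaussianProcess (fun (a : K) (x : C(K, ℝ)) => x a) P ∧
      (∀ a, ∫ x, x a ∂P = 0) ∧
      (∀ a a', cov[fun x : C(K, ℝ) => x a, fun x => x a'; P] = cov[φ a, φ a'; μ]) ∧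
      TendstoInDistribution Y atTop (fun x => x) (fun _ => μ) P := by
  set v : (K →₀ ℝ) → ℝ := fun w => Var[fun ω => w.sum fun a c => c * φ a ω; μ] with hv
  let Q : ℕ → ProbabilityMeasure C(K, ℝ) := fun n =>
    ⟨μ.map (Y n), Measure.isProbabilityMeasure_map (hY n).aemeasurable⟩
  have hcomp : IsCompact (closure (Set.range Q)) := by
    apply isCompact_closure_of_isTightMeasureSet
    convert! htight using 1
    ext ν
    constructor
    · rintro ⟨_, ⟨n, rfl⟩, rfl⟩
      exact ⟨n, rfl⟩
    · rintro ⟨n, rfl⟩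
      exact ⟨Q n, ⟨n, rfl⟩, rfl⟩
  -- Along an ultrafilter converging to the cluster point, the projected laws converge both to the
  -- projection of P and to the Gaussian law; limits are unique. All cluster points therefore share
  -- their projections and coincide.
  have hlaw : ∀ P : ProbabilityMeasure C(K, ℝ), MapClusterPt P atTop Q → ∀ w,
      (P : Measure C(K, ℝ)).map (evalComb w) = gaussianReal 0 (v w).toNNReal := by
    intro P hP w
    obtain ⟨U, hU, hUP⟩ := mapClusterPt_iff_ultrafilter.1 hP
    have h1 := ProbabilityMeasure.tendsto_map_of_tendsto_of_continuous _ _ hUP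
      (evalComb w).continuous
    have h2 := (hclt w).tendsto.mono_left hU
    have h3 := tendsto_nhds_unique (h1.congr fun n => ?_) h2
    · have := congrArg (fun R : ProbabilityMeasure ℝ => (R : Measure ℝ)) h3
      simpa using this
    · apply Subtype.ext
      exact Measure.map_map (evalComb w).continuous.measurable (hY n)
  obtain ⟨P, -, hP⟩ := hcomp.exists_mapClusterPt (u := Q) (f := atTop)
    (tendsto_principal.2 (Eventually.of_forall fun n => subset_closure (Set.mem_range_self n)))
  have hPw := hlaw P hP
  have hmapm (w : K →₀ ℝ) : AEMeasurable (evalComb w) (P : Measure C(K, ℝ)) :=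
    (evalComb w).continuous.aemeasurable
  have hvar (w : K →₀ ℝ) : Var[evalComb w; (P : Measure C(K, ℝ))] = v w := by
    have : Var[id; (P : Measure C(K, ℝ)).map (evalComb w)] = v w := by
      rw [hPw, variance_id_gaussianReal, Real.coe_toNNReal _ (variance_nonneg _ _)]
    rwa [variance_map aemeasurable_id (hmapm w)] at this
  have hmem (w : K →₀ ℝ) : MemLp (evalComb w) 2 (P : Measure C(K, ℝ)) := by
    have : MemLp id 2 ((P : Measure C(K, ℝ)).map (evalComb w)) := by
      rw [hPw]; exact memLp_id_gaussianReal' 2 (by simp)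
    exact (memLp_map_measure_iff aestronglyMeasurable_id (hmapm w)).1 this
  have hone (a : K) : (fun x : C(K, ℝ) => x a) = evalComb (Finsupp.single a 1) := by
    ext x; simp
  refine ⟨P, inferInstance, ⟨fun I => ⟨?_⟩⟩, ?_, ?_, ?_⟩
  · classical
    apply isGaussian_of_map_eq_gaussianReal
    intro L
    let w : K →₀ ℝ := ∑ i : I, Finsupp.single (i : K) (L (Pi.single i 1))
    refine ⟨0, (v w).toNNReal, ?_⟩
    rw [← hPw w, Measure.map_map L.continuous.measurable]
    · congr 1
      ext x
      have hw : evalComb w x = ∑ i : I, L (Pi.single i 1) * x i := by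
        have hsum : ∀ s : Finset I, evalComb (∑ i ∈ s, Finsupp.single (i : K) (L (Pi.single i 1))) x
            = ∑ i ∈ s, L (Pi.single i 1) * x i := by
          intro s
          induction s using Finset.induction_on with
          | empty => simp [evalComb_apply]
          | insert i s hi ih => rw [Finset.sum_insert hi, Finset.sum_insert hi, evalComb_add, ih,
              evalComb_single]
        exact hsum Finset.univ
      rw [hw, Function.comp_apply]
      have := L.toLinearMap.pi_apply_eq_sum_univ (I.restrict (fun a => x a))
      simp only [ContinuousLinearMap.coe_coe] at this
      rw [this]
      refine Finset.sum_congr rfl fun i _ => ?_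
      rw [smul_eq_mul, mul_comm]
      congr 2
      ext j
      simp only [Pi.single_apply, eq_comm]
    · exact measurable_pi_lambda _ fun i => (ContinuousMap.evalCLM ℝ (i : K)).continuous.measurable
  · intro a
    rw [hone]
    have : ∫ y, y ∂((P : Measure C(K, ℝ)).map (evalComb (Finsupp.single a 1))) = 0 := by
      rw [hPw, integral_id_gaussianReal]
    rwa [integral_map (hmapm _) measurable_id'.aestronglyMeasurable] at this
  -- Covariances are recovered from variances by polarization, as only the laws of single
  -- combinations are known.
  · intro a a'
    have e1 := variance_add (hmem (Finsupp.single a 1)) (hmem (Finsupp.single a' 1))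
    have e2 := variance_add (hφ a) (hφ a')
    have e3 : (evalComb (Finsupp.single a 1) + evalComb (Finsupp.single a' 1) : C(K, ℝ) → ℝ)
        = evalComb (Finsupp.single a 1 + Finsupp.single a' 1) := by
      ext x; simp [evalComb_add]
    have hv1 (a : K) : v (Finsupp.single a 1) = Var[φ a; μ] := by
      simp [hv, Finsupp.sum_single_index]
    have hv2 : v (Finsupp.single a 1 + Finsupp.single a' 1) = Var[φ a + φ a'; μ] := by
      simp only [hv]
      congr 1
      ext ω
      rw [Finsupp.sum_add_index' (by simp) (by intros; ring)]
      simp [Finsupp.sum_single_index]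
    rw [e3, hvar, hvar, hvar, hv1, hv1, hv2] at e1
    rw [hone, hone]
    linarith
  · refine ⟨fun n => (hY n).aemeasurable, aemeasurable_id, ?_⟩
    have hlim : Tendsto Q atTop (𝓝 P) := by
      refine hcomp.tendsto_nhds_of_unique_mapClusterPt
        (Eventually.of_forall fun n => subset_closure (Set.mem_range_self n)) ?_
      intro P' _ hP'
      exact Subtype.ext (ContinuousMap.measure_ext_of_evalComb (P := (P' : Measure C(K, ℝ)))
        (P' := (P : Measure C(K, ℝ))) fun w => (hlaw P' hP' w).trans (hPw w).symm)
    convert! hlim using 1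
    congr 1
    apply Subtype.ext
    exact Measure.map_id

end GaussianLimit

namespace RandomRate

/-! ### What the moment and majorant conditions give for the cumulant generating function. -/

section Cgf

variable {Ω : Type*} [MeasurableSpace Ω] {μ : Measure Ω}

lemma mem_interior_integrableExpSet {Z : Ω → ℝ}
    (h : ∀ θ : ℝ, Integrable (fun ω => Real.exp (θ * Z ω)) μ) (θ : ℝ) :
    θ ∈ interior (integrableExpSet Z μ) := by
  have : integrableExpSet Z μ = Set.univ := Set.eq_univ_of_forall h
  simp [this]

lemma contDiff_cgf {Z : Ω → ℝ} (h : ∀ θ : ℝ, Integrable (fun ω => Real.exp (θ * Z ω)) μ) :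
    ContDiff ℝ 2 (cgf Z μ) :=
  contDiff_iff_contDiffAt.2 fun θ => (analyticAt_cgf (mem_interior_integrableExpSet h θ)).contDiffAt

/-- The second derivative is the variance of Z under the exponentially tilted law; if it vanished, Z
would equal the tilted mean almost surely. -/
lemma iteratedDeriv_two_cgf_pos [IsProbabilityMeasure μ] {Z : Ω → ℝ}
    (h : ∀ θ : ℝ, Integrable (fun ω => Real.exp (θ * Z ω)) μ)
    (hZ : ¬ ∃ b : ℝ, ∀ᵐ ω ∂μ, Z ω = b) (θ : ℝ) : 0 < iteratedDeriv 2 (cgf Z μ) θ := by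
  have hθ := mem_interior_integrableExpSet h θ
  rw [iteratedDeriv_two_cgf_eq_integral hθ]
  refine div_pos ?_ (mgf_pos (h θ))
  set m := deriv (cgf Z μ) θ
  have hint : Integrable (fun ω => (Z ω - m) ^ 2 * Real.exp (θ * Z ω)) μ := by
    have h2 := integrable_pow_mul_exp_of_mem_interior_integrableExpSet hθ 2
    have h1 := integrable_pow_mul_exp_of_mem_interior_integrableExpSet hθ 1
    refine ((h2.sub (h1.const_mul (2 * m))).add ((h θ).const_mul (m ^ 2))).congr
      (Eventually.of_forall fun ω => ?_)
    simp only [Pi.add_apply, Pi.sub_apply]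
    ring
  have hnn : 0 ≤ fun ω => (Z ω - m) ^ 2 * Real.exp (θ * Z ω) := fun ω => by positivity
  refine lt_of_le_of_ne (integral_nonneg hnn) fun h0 => hZ ⟨m, ?_⟩
  filter_upwards [(integral_eq_zero_iff_of_nonneg hnn hint).1 h0.symm] with ω hω
  have : (Z ω - m) ^ 2 = 0 := by simpa [(Real.exp_pos _).ne'] using hω
  nlinarith [pow_eq_zero_iff two_ne_zero |>.1 this]

/-- The majorant holds almost surely for all rational θ at once, hence by continuity for all real θ.
Fix one such ω with `W ω ≠ 0`: then θ W(ω) sweeps the whole line while F(W(ω)) stays fixed. -/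
lemma exists_bound_iteratedDeriv_two_of_majorant {f : ℝ → ℝ} (hf : ContDiff ℝ 2 f)
    {W : Ω → ℝ} (hW : ¬ ∀ᵐ ω ∂μ, W ω = 0)
    {F : ℝ → ℝ} (hF : ∀ θ : ℝ, ∀ᵐ ω ∂μ, (W ω) ^ 2 * iteratedDeriv 2 f (θ * W ω) ≤ F (W ω)) :
    ∃ B, ∀ x, iteratedDeriv 2 f x ≤ B := by
  have hc : Continuous (iteratedDeriv 2 f) := hf.continuous_iteratedDeriv' 2
  have hQ : ∀ᵐ ω ∂μ, ∀ q : ℚ, (W ω) ^ 2 * iteratedDeriv 2 f (q * W ω) ≤ F (W ω) :=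
    ae_all_iff.2 fun q => hF q
  obtain ⟨ω, hω0, hω⟩ := ((not_eventually.1 hW).and_eventually hQ).exists
  have hall : ∀ θ : ℝ, (W ω) ^ 2 * iteratedDeriv 2 f (θ * W ω) ≤ F (W ω) := by
    have hcl : IsClosed {θ : ℝ | (W ω) ^ 2 * iteratedDeriv 2 f (θ * W ω) ≤ F (W ω)} :=
      isClosed_le (by fun_prop) continuous_const
    intro θ
    have := Rat.denseRange_cast (𝕜 := ℝ)
    exact (hcl.closure_subset_iff.2 (Set.range_subset_iff.2 hω)) (this θ)
  refine ⟨F (W ω) / (W ω) ^ 2, fun x => ?_⟩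
  have hpos : 0 < W ω ^ 2 := by positivity
  rw [le_div_iff₀ hpos, mul_comm]
  have := hall (x / W ω)
  rwa [div_mul_cancel₀ _ hω0] at this

/-- At θ = 0 the majorant reads W² f''(0) ≤ F(W). -/
lemma memLp_two_of_majorant {f : ℝ → ℝ} (hpos : 0 < iteratedDeriv 2 f 0)
    {W : Ω → ℝ} (hWm : Measurable W) {F : ℝ → ℝ} (hFi : Integrable (fun ω => F (W ω)) μ)
    (hF : ∀ θ : ℝ, ∀ᵐ ω ∂μ, (W ω) ^ 2 * iteratedDeriv 2 f (θ * W ω) ≤ F (W ω)) :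
    MemLp W 2 μ := by
  rw [memLp_two_iff_integrable_sq hWm.aestronglyMeasurable]
  refine (hFi.div_const (iteratedDeriv 2 f 0)).mono' (by fun_prop) ?_
  filter_upwards [hF 0] with ω hω
  rw [zero_mul] at hω
  rw [Real.norm_of_nonneg (sq_nonneg _), le_div_iff₀ hpos]
  exact hω

end Cgf

/-- The standing hypotheses in terms of `f = log E[exp(· Z)]` only: `f` is `C²` with positive
bounded second derivative, and `V` is an i.i.d. square integrable sequence, not a.s. zero. -/
structure ConvexScaleModel {Ω : Type*} [MeasurableSpace Ω] (f : ℝ → ℝ) (V : ℕ → Ω → ℝ)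
    (μ : Measure Ω) : Prop where
  contDiff : ContDiff ℝ 2 f
  deriv2_pos : ∀ x, 0 < iteratedDeriv 2 f x
  deriv2_bdd : ∃ B, ∀ x, iteratedDeriv 2 f x ≤ B
  measurable : ∀ j, Measurable (V j)
  indep : iIndepFun V μ
  ident : ∀ j, IdentDistrib (V j) (V 0) μ μ
  memLp : MemLp (V 0) 2 μ
  nonzero : ¬ ∀ᵐ ω ∂μ, V 0 ω = 0

lemma IsModel.convexScaleModel {Ω : Type*} [MeasurableSpace Ω] {μ : Measure Ω}
    [IsProbabilityMeasure μ] {W Z : ℕ → Ω → ℝ} (hmodel : IsModel W Z μ)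
    (hLD : LDConditions (W 0) (Z 0) μ) (hW : ¬ ∀ᵐ ω ∂μ, W 0 ω = 0) :
    ConvexScaleModel (cgf (Z 0) μ) W μ := by
  obtain ⟨F, hFi, hF⟩ := hLD.majorant
  have hpos := iteratedDeriv_two_cgf_pos hLD.mgf_finite hLD.nondegenerate
  have hC := contDiff_cgf hLD.mgf_finite
  exact ⟨hC, hpos, exists_bound_iteratedDeriv_two_of_majorant hC hW hF, hmodel.measurable_W,
    hmodel.indep_W, hmodel.ident_W,
    memLp_two_of_majorant (hpos 0) (hmodel.measurable_W 0) hFi hF, hW⟩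

/-! ### Domination, and differentiation of g under the integral. -/

namespace ConvexScaleModel

variable {Ω : Type*} [MeasurableSpace Ω] {μ : Measure Ω}
  {f : ℝ → ℝ} {V : ℕ → Ω → ℝ}

lemma hasDerivAt (h : ConvexScaleModel f V μ) (x : ℝ) : HasDerivAt f (deriv f x) x :=
  (h.contDiff.differentiable (by norm_num) x).hasDerivAt

lemma hasDerivAt_deriv (h : ConvexScaleModel f V μ) (x : ℝ) :
    HasDerivAt (deriv f) (iteratedDeriv 2 f x) x := by
  have h1 : ContDiff ℝ 1 (deriv f) := (contDiff_succ_iff_deriv.1 h.contDiff).2.2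
  rw [iteratedDeriv_succ, iteratedDeriv_one]
  exact (h1.differentiable (by norm_num) x).hasDerivAt

lemma continuous_deriv2 (h : ConvexScaleModel f V μ) : Continuous (iteratedDeriv 2 f) :=
  h.contDiff.continuous_iteratedDeriv' 2

lemma continuous_deriv (h : ConvexScaleModel f V μ) : Continuous (deriv f) :=
  continuous_iff_continuousAt.2 fun x => (h.hasDerivAt_deriv x).continuousAt

lemma hasDerivAt_scale (h : ConvexScaleModel f V μ) (w θ : ℝ) :
    HasDerivAt (fun t => f (w * t)) (w * deriv f (w * θ)) θ := by
  have := (h.hasDerivAt (w * θ)).comp θ ((hasDerivAt_id θ).const_mul w)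
  convert! this using 1
  simp [mul_comm]

lemma hasDerivAt_scale_deriv (h : ConvexScaleModel f V μ) (w θ : ℝ) :
    HasDerivAt (fun t => w * deriv f (w * t)) (w ^ 2 * iteratedDeriv 2 f (w * θ)) θ := by
  have := ((h.hasDerivAt_deriv (w * θ)).comp θ ((hasDerivAt_id θ).const_mul w)).const_mul w
  convert! this using 1
  simp; ring

lemma abs_deriv_le (h : ConvexScaleModel f V μ) {B : ℝ} (hB : ∀ x, iteratedDeriv 2 f x ≤ B)
    (x : ℝ) : |deriv f x| ≤ |deriv f 0| + B * |x| := by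
  have := convex_univ.norm_image_sub_le_of_norm_hasDerivWithin_le (C := B)
    (fun x _ => (h.hasDerivAt_deriv x).hasDerivWithinAt)
    (fun x _ => by rw [Real.norm_of_nonneg (h.deriv2_pos x).le]; exact hB x)
    (Set.mem_univ 0) (Set.mem_univ x)
  simp only [Real.norm_eq_abs, sub_zero] at this
  calc |deriv f x| = |deriv f 0 + (deriv f x - deriv f 0)| := by ring_nf
    _ ≤ _ := (abs_add_le _ _).trans (by gcongr)

lemma aestronglyMeasurable_scale (h : ConvexScaleModel f V μ) (θ : ℝ) :
    AEStronglyMeasurable (fun ω => f (V 0 ω * θ)) μ :=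
  (h.contDiff.continuous.measurable.comp ((h.measurable 0).mul_const θ)).aestronglyMeasurable

lemma integrable (h : ConvexScaleModel f V μ) [IsProbabilityMeasure μ] : Integrable (V 0) μ :=
  h.memLp.integrable (by norm_num)

lemma integrable_sq (h : ConvexScaleModel f V μ) : Integrable (fun ω => V 0 ω ^ 2) μ :=
  h.memLp.integrable_sq

/-- An integrable bound for `w f'(w θ)`, uniform for bounded `θ`. -/
lemma abs_scale_deriv_le (h : ConvexScaleModel f V μ) {B : ℝ} (hB : ∀ x, iteratedDeriv 2 f x ≤ B)
    {R θ : ℝ} (hθ : |θ| ≤ R) (w : ℝ) :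
    |w * deriv f (w * θ)| ≤ |deriv f 0| * |w| + B * R * w ^ 2 := by
  have hB0 : 0 ≤ B := (h.deriv2_pos 0).le.trans (hB 0)
  calc |w * deriv f (w * θ)| = |w| * |deriv f (w * θ)| := abs_mul _ _
    _ ≤ |w| * (|deriv f 0| + B * (|w| * R)) := by
      gcongr
      refine (h.abs_deriv_le hB _).trans ?_
      rw [abs_mul]; gcongr
    _ = _ := by rw [← sq_abs w]; ring

lemma abs_scale_deriv2_le (h : ConvexScaleModel f V μ) {B : ℝ}
    (hB : ∀ x, iteratedDeriv 2 f x ≤ B) (w θ : ℝ) :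
    |w ^ 2 * iteratedDeriv 2 f (w * θ)| ≤ B * w ^ 2 := by
  rw [abs_of_nonneg (mul_nonneg (sq_nonneg _) (h.deriv2_pos _).le), mul_comm]
  exact mul_le_mul_of_nonneg_right (hB _) (sq_nonneg _)

lemma integrable_scale_deriv2 (h : ConvexScaleModel f V μ) (θ : ℝ) :
    Integrable (fun ω => V 0 ω ^ 2 * iteratedDeriv 2 f (V 0 ω * θ)) μ := by
  obtain ⟨B, hB⟩ := h.deriv2_bdd
  have := h.measurable 0
  have := h.continuous_deriv2.measurable
  exact (h.integrable_sq.const_mul B).mono' (by fun_prop)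
    (Eventually.of_forall fun ω => h.abs_scale_deriv2_le hB _ _)

lemma continuous_integral_deriv2 (h : ConvexScaleModel f V μ) :
    Continuous fun θ => ∫ ω, V 0 ω ^ 2 * iteratedDeriv 2 f (V 0 ω * θ) ∂μ := by
  obtain ⟨B, hB⟩ := h.deriv2_bdd
  have := h.measurable 0
  have hc := h.continuous_deriv2
  have := hc.measurable
  exact continuous_of_dominated (fun θ => by fun_prop)
    (fun θ => Eventually.of_forall fun ω => h.abs_scale_deriv2_le hB (V 0 ω) θ)
    (h.integrable_sq.const_mul B) (Eventually.of_forall fun ω => by fun_prop)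

lemma integral_deriv2_pos (h : ConvexScaleModel f V μ) (θ : ℝ) :
    0 < ∫ ω, V 0 ω ^ 2 * iteratedDeriv 2 f (V 0 ω * θ) ∂μ := by
  have hnn : 0 ≤ fun ω => V 0 ω ^ 2 * iteratedDeriv 2 f (V 0 ω * θ) :=
    fun ω => mul_nonneg (sq_nonneg _) (h.deriv2_pos _).le
  refine lt_of_le_of_ne (integral_nonneg hnn) fun h0 => h.nonzero ?_
  filter_upwards [(integral_eq_zero_iff_of_nonneg hnn (h.integrable_scale_deriv2 θ)).1 h0.symm]
    with ω hω
  simpa [(h.deriv2_pos _).ne'] using hω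

variable [IsProbabilityMeasure μ]

lemma integrable_bound (h : ConvexScaleModel f V μ) (c d : ℝ) :
    Integrable (fun ω => c * |V 0 ω| + d * V 0 ω ^ 2) μ :=
  (h.integrable.abs.const_mul c).add (h.integrable_sq.const_mul d)

lemma integrable_scale_deriv (h : ConvexScaleModel f V μ) (θ : ℝ) :
    Integrable (fun ω => V 0 ω * deriv f (V 0 ω * θ)) μ := by
  obtain ⟨B, hB⟩ := h.deriv2_bdd
  have := h.measurable 0
  have := h.continuous_deriv.measurable
  exact (h.integrable_bound _ _).mono' (by fun_prop)
    (Eventually.of_forall fun ω => h.abs_scale_deriv_le hB le_rfl _)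

lemma integrable_scale (h : ConvexScaleModel f V μ) (θ : ℝ) :
    Integrable (fun ω => f (V 0 ω * θ)) μ := by
  obtain ⟨B, hB⟩ := h.deriv2_bdd
  refine ((integrable_const |f 0|).add (h.integrable_bound (|deriv f 0| * |θ|)
    (B * |θ| * |θ|))).mono' (h.aestronglyMeasurable_scale θ) (Eventually.of_forall fun ω => ?_)
  have := (convex_closedBall (0 : ℝ) |θ|).norm_image_sub_le_of_norm_hasDerivWithin_le
    (fun x _ => (h.hasDerivAt_scale (V 0 ω) x).hasDerivWithinAt)
    (fun x hx => h.abs_scale_deriv_le hB (by simpa using hx) (V 0 ω))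
    (Metric.mem_closedBall_self (abs_nonneg _)) (y := θ) (by simp)
  simp only [Real.norm_eq_abs, sub_zero, mul_zero] at this
  calc ‖f (V 0 ω * θ)‖ = |f 0 + (f (V 0 ω * θ) - f 0)| := by rw [Real.norm_eq_abs]; ring_nf
    _ ≤ |f 0| + |f (V 0 ω * θ) - f 0| := abs_add_le _ _
    _ ≤ |f 0| + _ := add_le_add le_rfl this
    _ = _ := by simp only [Pi.add_apply]; ring

lemma hasDerivAt_integral (h : ConvexScaleModel f V μ) (θ : ℝ) :
    HasDerivAt (fun t => ∫ ω, f (V 0 ω * t) ∂μ) (∫ ω, V 0 ω * deriv f (V 0 ω * θ) ∂μ) θ := by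
  obtain ⟨B, hB⟩ := h.deriv2_bdd
  have := h.measurable 0
  have := h.continuous_deriv.measurable
  refine (hasDerivAt_integral_of_dominated_loc_of_deriv_le (Metric.ball_mem_nhds θ one_pos)
    (Eventually.of_forall h.aestronglyMeasurable_scale) (h.integrable_scale θ) (by fun_prop)
    (Eventually.of_forall fun ω t ht => h.abs_scale_deriv_le hB (R := |θ| + 1) ?_ (V 0 ω))
    (h.integrable_bound _ _)
    (Eventually.of_forall fun ω t _ => h.hasDerivAt_scale (V 0 ω) t)).2
  rw [Metric.mem_ball, Real.dist_eq] at ht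
  calc |t| = |θ + (t - θ)| := by ring_nf
    _ ≤ |θ| + |t - θ| := abs_add_le _ _
    _ ≤ _ := by linarith

lemma hasDerivAt_integral_deriv (h : ConvexScaleModel f V μ) (θ : ℝ) :
    HasDerivAt (fun t => ∫ ω, V 0 ω * deriv f (V 0 ω * t) ∂μ)
      (∫ ω, V 0 ω ^ 2 * iteratedDeriv 2 f (V 0 ω * θ) ∂μ) θ := by
  obtain ⟨B, hB⟩ := h.deriv2_bdd
  have := h.measurable 0
  have := h.continuous_deriv.measurable
  have := h.continuous_deriv2.measurable
  exact (hasDerivAt_integral_of_dominated_loc_of_deriv_le (Metric.ball_mem_nhds θ one_pos)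
    (Eventually.of_forall fun t => by fun_prop) (h.integrable_scale_deriv θ) (by fun_prop)
    (Eventually.of_forall fun ω t _ => h.abs_scale_deriv2_le hB (V 0 ω) t)
    (h.integrable_sq.const_mul B)
    (Eventually.of_forall fun ω t _ => h.hasDerivAt_scale_deriv (V 0 ω) t)).2

lemma strictMono_integral_deriv (h : ConvexScaleModel f V μ) :
    StrictMono fun θ => ∫ ω, V 0 ω * deriv f (V 0 ω * θ) ∂μ :=
  strictMono_of_hasDerivAt_pos h.hasDerivAt_integral_deriv h.integral_deriv2_pos

end ConvexScaleModel

end RandomRate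

namespace RandomRate

/-! ### Empirical means and the law of large numbers. -/

section Empirical

/-- The empirical mean of `φ` over the first `n` terms of `v`. -/
noncomputable def empMean (n : ℕ) (v : ℕ → ℝ) (φ : ℝ → ℝ) : ℝ :=
  (1 / (n : ℝ)) * ∑ j ∈ Finset.range n, φ (v j)

lemma empMean_mono {n : ℕ} {v : ℕ → ℝ} {φ ψ : ℝ → ℝ} (h : ∀ x, φ x ≤ ψ x) :
    empMean n v φ ≤ empMean n v ψ :=
  mul_le_mul_of_nonneg_left (Finset.sum_le_sum fun _ _ => h _) (by positivity)

lemma empMean_sub (n : ℕ) (v : ℕ → ℝ) (φ ψ : ℝ → ℝ) :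
    empMean n v φ - empMean n v ψ = empMean n v fun x => φ x - ψ x := by
  simp [empMean, Finset.sum_sub_distrib, mul_sub]

lemma abs_empMean_le (n : ℕ) (v : ℕ → ℝ) (φ : ℝ → ℝ) :
    |empMean n v φ| ≤ empMean n v fun x => |φ x| := by
  rw [empMean, abs_mul, abs_of_nonneg (by positivity : (0 : ℝ) ≤ 1 / n)]
  exact mul_le_mul_of_nonneg_left (Finset.abs_sum_le_sum_abs _ _) (by positivity)

lemma hasDerivAt_empMean {φ φ' : ℝ → ℝ → ℝ} {θ : ℝ}
    (h : ∀ x, HasDerivAt (fun t => φ t x) (φ' θ x) θ) (n : ℕ) (v : ℕ → ℝ) :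
    HasDerivAt (fun t => empMean n v (φ t)) (empMean n v (φ' θ)) θ := by
  unfold empMean
  exact (HasDerivAt.fun_sum fun j _ => h (v j)).const_mul _

variable {Ω : Type*} [MeasurableSpace Ω] {μ : Measure Ω} {V : ℕ → Ω → ℝ}

lemma measurable_empMean (hV : ∀ j, Measurable (V j)) {φ : ℝ → ℝ} (hφ : Measurable φ) (n : ℕ) :
    Measurable fun ω => empMean n (fun j => V j ω) φ := by
  unfold empMean
  exact (Finset.measurable_sum _ fun j _ => hφ.comp (hV j)).const_mul _

lemma ae_tendsto_empMean (hindep : iIndepFun V μ)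
    (hident : ∀ j, IdentDistrib (V j) (V 0) μ μ) {φ : ℝ → ℝ} (hφ : Measurable φ)
    (hint : Integrable (fun ω => φ (V 0 ω)) μ) :
    ∀ᵐ ω ∂μ, Tendsto (fun n => empMean n (fun j => V j ω) φ) atTop (𝓝 (∫ ω, φ (V 0 ω) ∂μ)) := by
  have := strong_law_ae_real (fun j ω => φ (V j ω)) hint
    (fun i j hij => (hindep.indepFun hij).comp hφ hφ) (fun j => (hident j).comp hφ)
  filter_upwards [this] with ω hω
  refine hω.congr fun n => ?_
  rw [empMean, one_div, inv_mul_eq_div]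

variable [IsProbabilityMeasure μ]

lemma tendsto_measure_compl_of_ae_eventually_mem {A : ℕ → Set Ω} (hA : ∀ n, MeasurableSet (A n))
    (h : ∀ᵐ ω ∂μ, ∀ᶠ n in atTop, ω ∈ A n) : Tendsto (fun n => μ (A n)ᶜ) atTop (𝓝 0) := by
  have := tendsto_measure_of_ae_tendsto_indicator_of_isFiniteMeasure (μ := μ) atTop
    (A := ∅) MeasurableSet.empty (fun n => (hA n).compl)
    (h.mono fun ω hω => hω.mono fun n hn => by simpa using hn)
  simpa using this

end Empirical

/-! ### Uniform control of the empirical second derivative. -/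

namespace ConvexScaleModel

variable {Ω : Type*} [MeasurableSpace Ω] {μ : Measure Ω}
  {f : ℝ → ℝ} {V : ℕ → Ω → ℝ}

lemma hasDerivAt_empMean_scale (h : ConvexScaleModel f V μ) (n : ℕ) (v : ℕ → ℝ) (θ : ℝ) :
    HasDerivAt (fun t => empMean n v fun w => f (w * t))
      (empMean n v fun w => w * deriv f (w * θ)) θ :=
  hasDerivAt_empMean (φ' := fun θ w => w * deriv f (w * θ)) (fun w => h.hasDerivAt_scale w θ) n v

lemma hasDerivAt_empMean_scale_deriv (h : ConvexScaleModel f V μ) (n : ℕ) (v : ℕ → ℝ) (θ : ℝ) :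
    HasDerivAt (fun t => empMean n v fun w => w * deriv f (w * t))
      (empMean n v fun w => w ^ 2 * iteratedDeriv 2 f (w * θ)) θ :=
  hasDerivAt_empMean (φ' := fun θ w => w ^ 2 * iteratedDeriv 2 f (w * θ))
    (fun w => h.hasDerivAt_scale_deriv w θ) n v

/-- Positivity at a single t rules out n = 0 and produces a nonzero sample point; since f'' > 0
everywhere, the second derivative is then positive at every θ. -/
lemma strictMono_empMean_scale_deriv (h : ConvexScaleModel f V μ) {n : ℕ} {v : ℕ → ℝ} {t : ℝ}
    (hpos : 0 < empMean n v fun w => w ^ 2 * iteratedDeriv 2 f (w * t)) :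
    StrictMono fun θ => empMean n v fun w => w * deriv f (w * θ) := by
  refine strictMono_of_hasDerivAt_pos (h.hasDerivAt_empMean_scale_deriv n v) fun θ => ?_
  have hn : 0 < (1 / (n : ℝ)) := by
    by_contra hn
    have : (1 / (n : ℝ)) = 0 := le_antisymm (not_lt.1 hn) (by positivity)
    simp [empMean, this] at hpos
  obtain ⟨j, hj, hj0⟩ : ∃ j ∈ Finset.range n, v j ≠ 0 := by
    by_contra! hall
    have : ∑ j ∈ Finset.range n, v j ^ 2 * iteratedDeriv 2 f (v j * t) = 0 :=
      Finset.sum_eq_zero fun j hj => by simp [hall j hj]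
    simp [empMean, this] at hpos
  refine mul_pos hn (Finset.sum_pos' (fun i _ => mul_nonneg (sq_nonneg _) (h.deriv2_pos _).le)
    ⟨j, hj, mul_pos (by positivity) (h.deriv2_pos _)⟩)

/-- An integrable minorant, of positive mean, of `w² f''(w θ)` for bounded `θ`. -/
lemma exists_minorant_deriv2 (h : ConvexScaleModel f V μ) (R : ℝ) :
    ∃ φ : ℝ → ℝ, Measurable φ ∧ Integrable (fun ω => φ (V 0 ω)) μ ∧
      0 < ∫ ω, φ (V 0 ω) ∂μ ∧ ∀ w θ, |θ| ≤ R → φ w ≤ w ^ 2 * iteratedDeriv 2 f (w * θ) := by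
  have hVm := h.measurable 0
  -- M is a truncation level below which `V 0` is still not almost surely zero. For |w| ≤ M and |θ|
  -- ≤ R the argument wθ stays in a compact ball, where f'' has a positive minimum κ; the minorant
  -- is κ w² cut off at M.
  obtain ⟨M, hM⟩ : ∃ M : ℕ, ¬ ∀ᵐ ω ∂μ, |V 0 ω| ≤ M → V 0 ω = 0 := by
    by_contra! hall
    apply h.nonzero
    filter_upwards [ae_all_iff.2 hall] with ω hω
    obtain ⟨M, hM⟩ := exists_nat_ge |V 0 ω|
    exact hω M hM
  obtain ⟨x₀, -, hx₀⟩ := (isCompact_closedBall (0 : ℝ) (M * |R|)).exists_isMinOn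
    ⟨0, by simp; positivity⟩ h.continuous_deriv2.continuousOn
  set κ := iteratedDeriv 2 f x₀ with hκ
  have hκ0 : 0 < κ := h.deriv2_pos x₀
  set S : Set ℝ := {w | |w| ≤ M} with hS
  have hSm : MeasurableSet S := measurableSet_le (by fun_prop) measurable_const
  set φ : ℝ → ℝ := S.indicator fun w => κ * w ^ 2 with hφ
  have hφm : Measurable φ := Measurable.indicator (by fun_prop) hSm
  have hφ0 : ∀ w, 0 ≤ φ w := fun w => Set.indicator_nonneg (fun w _ => by positivity) w
  have hφi : Integrable (fun ω => φ (V 0 ω)) μ := by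
    refine (h.integrable_sq.const_mul κ).mono' (hφm.comp hVm).aestronglyMeasurable
      (Eventually.of_forall fun ω => ?_)
    rw [Real.norm_of_nonneg (hφ0 _)]
    exact Set.indicator_le_self' (fun w _ => by positivity) _
  refine ⟨φ, hφm, hφi, ?_, ?_⟩
  · refine lt_of_le_of_ne (integral_nonneg fun ω => hφ0 _) fun h0 => hM ?_
    filter_upwards [(integral_eq_zero_iff_of_nonneg (fun ω => hφ0 _) hφi).1 h0.symm] with ω hω hωM
    have : φ (V 0 ω) = κ * V 0 ω ^ 2 := Set.indicator_of_mem (by exact hωM) _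
    simpa [this, hκ0.ne'] using hω
  · intro w θ hθ
    by_cases hw : w ∈ S
    · rw [hφ, Set.indicator_of_mem hw, mul_comm]
      refine mul_le_mul_of_nonneg_left (hx₀ ?_) (sq_nonneg _)
      rw [mem_closedBall_zero_iff, Real.norm_eq_abs, abs_mul]
      exact mul_le_mul hw (hθ.trans (le_abs_self _)) (abs_nonneg _) (by positivity)
    · rw [hφ, Set.indicator_of_notMem hw]
      exact mul_nonneg (sq_nonneg _) (h.deriv2_pos _).le

variable [IsProbabilityMeasure μ]

/-- A modulus of continuity of small mean for `θ ↦ w² f''(w θ)` on bounded sets. -/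
lemma exists_modulus_deriv2 (h : ConvexScaleModel f V μ) (R : ℝ) {η : ℝ} (hη : 0 < η) :
    ∃ δ > 0, ∃ φ : ℝ → ℝ, Measurable φ ∧ Integrable (fun ω => φ (V 0 ω)) μ ∧
      ∫ ω, φ (V 0 ω) ∂μ < η ∧ ∀ w θ θ', |θ| ≤ R → |θ'| ≤ R → |θ - θ'| ≤ δ →
        |w ^ 2 * iteratedDeriv 2 f (w * θ) - w ^ 2 * iteratedDeriv 2 f (w * θ')| ≤ φ w := by
  have hVm := h.measurable 0
  obtain ⟨B, hB⟩ := h.deriv2_bdd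
  have hB0 : 0 < B := (h.deriv2_pos 0).trans_le (hB 0)
  -- Beyond M the oscillation is at most B w², whose tail has small mean by dominated convergence.
  -- Below M, joint uniform continuity on a compact product bounds it by η/2.
  set ψ : ℕ → ℝ → ℝ := fun M => {w : ℝ | (M : ℝ) < |w|}.indicator fun w => B * w ^ 2 with hψ
  have hSm (M : ℕ) : MeasurableSet {w : ℝ | (M : ℝ) < |w|} :=
    measurableSet_lt measurable_const (by fun_prop)
  have hψm (M : ℕ) : Measurable (ψ M) := Measurable.indicator (by fun_prop) (hSm M)
  have hψ0 (M : ℕ) (w : ℝ) : 0 ≤ ψ M w := Set.indicator_nonneg (fun w _ => by positivity) w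
  have hψle (M : ℕ) (w : ℝ) : ‖ψ M w‖ ≤ B * w ^ 2 := by
    rw [Real.norm_of_nonneg (hψ0 M w)]
    exact Set.indicator_le_self' (fun w _ => by positivity) _
  have hψi (M : ℕ) : Integrable (fun ω => ψ M (V 0 ω)) μ :=
    (h.integrable_sq.const_mul B).mono' ((hψm M).comp hVm).aestronglyMeasurable
      (Eventually.of_forall fun ω => hψle M _)
  have hlim : Tendsto (fun M => ∫ ω, ψ M (V 0 ω) ∂μ) atTop (𝓝 (∫ _, 0 ∂μ)) := by
    refine tendsto_integral_of_dominated_convergence _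
      (fun M => ((hψm M).comp hVm).aestronglyMeasurable) (h.integrable_sq.const_mul B)
      (fun M => Eventually.of_forall fun ω => hψle M _) (Eventually.of_forall fun ω => ?_)
    obtain ⟨M₀, hM₀⟩ := exists_nat_ge |V 0 ω|
    refine tendsto_const_nhds.congr' ?_
    filter_upwards [eventually_ge_atTop M₀] with M hM
    refine (Set.indicator_of_notMem ?_ _).symm
    simp only [Set.mem_ofPred_eq, not_lt]
    exact hM₀.trans (by exact_mod_cast hM)
  rw [integral_zero] at hlim
  obtain ⟨M, hM⟩ := (hlim.eventually_lt_const (half_pos hη)).exists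
  have hcont : Continuous fun p : ℝ × ℝ => p.1 ^ 2 * iteratedDeriv 2 f (p.1 * p.2) := by
    have := h.continuous_deriv2
    fun_prop
  have huc := ((isCompact_closedBall (0 : ℝ) M).prod
    (isCompact_closedBall (0 : ℝ) R)).uniformContinuousOn_of_continuous hcont.continuousOn
  rw [Metric.uniformContinuousOn_iff] at huc
  obtain ⟨δ, hδ, huc⟩ := huc (η / 2) (half_pos hη)
  refine ⟨δ / 2, half_pos hδ, fun w => η / 2 + ψ M w, by fun_prop,
    (integrable_const _).add (hψi M), ?_, ?_⟩
  · rw [integral_add (integrable_const _) (hψi M)]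
    simp
    linarith
  · intro w θ θ' hθ hθ' hd
    by_cases hw : (M : ℝ) < |w|
    · have : ψ M w = B * w ^ 2 := Set.indicator_of_mem (by exact hw) _
      change _ ≤ η / 2 + ψ M w
      rw [this]
      have h1 := h.abs_scale_deriv2_le hB w θ
      have h2 := h.abs_scale_deriv2_le hB w θ'
      have h3 := mul_nonneg (sq_nonneg w) (h.deriv2_pos (w * θ)).le
      have h4 := mul_nonneg (sq_nonneg w) (h.deriv2_pos (w * θ')).le
      rw [abs_of_nonneg h3] at h1
      rw [abs_of_nonneg h4] at h2
      rw [abs_le]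
      constructor <;> linarith
    · change _ ≤ η / 2 + ψ M w
      have h1 := huc (w, θ) ⟨by simpa using hw, by simpa using hθ⟩ (w, θ')
        ⟨by simpa using hw, by simpa using hθ'⟩ (by
          rw [Prod.dist_eq]; simp only [dist_self, Real.dist_eq]
          rw [max_lt_iff]; exact ⟨hδ, by linarith⟩)
      rw [Real.dist_eq] at h1
      linarith [hψ0 M w]

end ConvexScaleModel

end RandomRate

namespace RandomRate

/-! ### Rescaled fluctuations and their moments. -/

section Fluct

/-- The rescaled fluctuation `n^{-1/2} ∑_{j < n} (φ (v j) - c)`. -/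
noncomputable def fluct (n : ℕ) (v : ℕ → ℝ) (φ : ℝ → ℝ) (c : ℝ) : ℝ :=
  (1 / √(n : ℝ)) * ∑ j ∈ Finset.range n, (φ (v j) - c)

lemma empMean_eq_add_fluct {n : ℕ} (hn : 1 ≤ n) (v : ℕ → ℝ) (φ : ℝ → ℝ) (c : ℝ) :
    empMean n v φ = c + (1 / √(n : ℝ)) * fluct n v φ c := by
  have hn0 : (0 : ℝ) < n := by exact_mod_cast hn
  have hs : √(n : ℝ) * √n = n := Real.mul_self_sqrt hn0.le
  rw [empMean, fluct, Finset.sum_sub_distrib, ← mul_assoc, div_mul_div_comm, hs]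
  simp
  field_simp
  ring

lemma hasDerivAt_fluct {φ φ' : ℝ → ℝ → ℝ} {c : ℝ → ℝ} {c' θ : ℝ}
    (h : ∀ x, HasDerivAt (fun t => φ t x) (φ' θ x) θ) (hc : HasDerivAt c c' θ)
    (n : ℕ) (v : ℕ → ℝ) :
    HasDerivAt (fun t => fluct n v (φ t) (c t)) (fluct n v (φ' θ) c') θ := by
  unfold fluct
  exact (HasDerivAt.fun_sum fun j _ => (h (v j)).sub hc).const_mul _

variable {Ω : Type*} [MeasurableSpace Ω] {μ : Measure Ω} {V : ℕ → Ω → ℝ}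

lemma measurable_fluct (hV : ∀ j, Measurable (V j)) {φ : ℝ → ℝ} (hφ : Measurable φ) (c : ℝ)
    (n : ℕ) : Measurable fun ω => fluct n (fun j => V j ω) φ c := by
  unfold fluct
  exact (Finset.measurable_sum _ fun j _ => (hφ.comp (hV j)).sub_const c).const_mul _

lemma exists_forall_measure_le_of_lintegral_le {ι : Type*} {L : ι → Ω → ENNReal}
    (hL : ∀ i, Measurable (L i)) {D : ENNReal} (hD : D ≠ ⊤) (hLD : ∀ i, ∫⁻ ω, L i ω ∂μ ≤ D)
    {ε : ENNReal} (hε : 0 < ε) :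
    ∃ R : ℝ, 0 < R ∧ ∀ i, μ {ω | ENNReal.ofReal R ≤ L i ω} ≤ ε := by
  have : Tendsto (fun R : ℝ => D / ENNReal.ofReal R) atTop (𝓝 (D / ⊤)) :=
    ENNReal.Tendsto.const_div ENNReal.tendsto_ofReal_atTop (Or.inr hD)
  rw [ENNReal.div_top] at this
  obtain ⟨R, hR, hR0⟩ := ((this.eventually_lt_const hε).and (eventually_gt_atTop 0)).exists
  refine ⟨R, hR0, fun i => ?_⟩
  calc μ {ω | ENNReal.ofReal R ≤ L i ω} ≤ (∫⁻ ω, L i ω ∂μ) / ENNReal.ofReal R :=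
        meas_ge_le_lintegral_div (hL i).aemeasurable (by simpa using hR0) (by simp)
    _ ≤ D / ENNReal.ofReal R := by gcongr; exact hLD i
    _ ≤ ε := hR.le

variable [IsProbabilityMeasure μ]

/-- Independence makes the second moment of the fluctuation at most the variance of one summand,
whatever n is; |x| ≤ 1 + x² turns this into a first moment bound. -/
lemma lintegral_enorm_fluct_le (hindep : iIndepFun V μ)
    (hident : ∀ j, IdentDistrib (V j) (V 0) μ μ) {φ : ℝ → ℝ} (hφ : Measurable φ)
    (hL : MemLp (fun ω => φ (V 0 ω)) 2 μ) {C : ℝ} (hC : Var[fun ω => φ (V 0 ω); μ] ≤ C) (n : ℕ) :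
    ∫⁻ ω, ‖fluct n (fun j => V j ω) φ (∫ ω, φ (V 0 ω) ∂μ)‖ₑ ∂μ ≤ ENNReal.ofReal (1 + C) := by
  set c := ∫ ω, φ (V 0 ω) ∂μ with hc
  have hid (j : ℕ) : IdentDistrib (fun ω => φ (V j ω)) (fun ω => φ (V 0 ω)) μ μ :=
    (hident j).comp hφ
  have hLj (j : ℕ) : MemLp (fun ω => φ (V j ω)) 2 μ := (hid j).memLp_iff.2 hL
  set S : Ω → ℝ := fun ω => fluct n (fun j => V j ω) φ c with hS
  set T : Ω → ℝ := ∑ j ∈ Finset.range n, fun ω => φ (V j ω) with hT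
  have hTL : MemLp T 2 μ := memLp_finsetSum' _ fun j _ => hLj j
  have hTint : ∫ ω, T ω ∂μ = n * c := by
    simp only [hT, Finset.sum_apply]
    rw [integral_finsetSum _ fun j _ => (hLj j).integrable (by norm_num)]
    simp [fun j => (hid j).integral_eq, hc]
  have hTvar : Var[T; μ] = n * Var[fun ω => φ (V 0 ω); μ] := by
    rw [hT, IndepFun.variance_sum (fun j _ => hLj j)
      (fun i _ j _ hij => (hindep.indepFun hij).comp hφ hφ)]
    simp [fun j => (hid j).variance_eq]
  have hST : S = fun ω => (1 / √(n : ℝ)) * (T ω - n * c) := by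
    ext ω
    simp [hS, hT, fluct, Finset.sum_sub_distrib]
  have hSL : MemLp S 2 μ := by
    rw [hST]
    exact (hTL.sub (memLp_const _)).const_mul _
  have hsq : ∫ ω, S ω ^ 2 ∂μ ≤ C := by
    have h1 : ∫ ω, (T ω - n * c) ^ 2 ∂μ = n * Var[fun ω => φ (V 0 ω); μ] := by
      rw [← hTvar, variance_eq_integral hTL.aestronglyMeasurable.aemeasurable, hTint]
    simp only [hST, mul_pow]
    rw [integral_const_mul, h1, div_pow, one_pow, Real.sq_sqrt (by positivity)]
    rcases Nat.eq_zero_or_pos n with rfl | hn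
    · simpa using (variance_nonneg _ _).trans hC
    · rw [← mul_assoc, one_div_mul_cancel (by positivity), one_mul]
      exact hC
  have hSi : Integrable S μ := hSL.integrable (by norm_num)
  rw [← ofReal_integral_norm_eq_lintegral_enorm hSi]
  apply ENNReal.ofReal_le_ofReal
  calc ∫ ω, ‖S ω‖ ∂μ ≤ ∫ ω, (1 + S ω ^ 2) ∂μ := by
        refine integral_mono hSi.norm ((integrable_const _).add hSL.integrable_sq) fun ω => ?_
        simp only [Real.norm_eq_abs]
        nlinarith [sq_abs (S ω), sq_nonneg (|S ω| - 1), abs_nonneg (S ω)]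
    _ = 1 + ∫ ω, S ω ^ 2 ∂μ := by
        rw [integral_add (integrable_const _) hSL.integrable_sq]; simp
    _ ≤ 1 + C := by linarith

end Fluct

/-! ### Uniform bound in probability for the derivative of the fluctuations. -/

namespace ConvexScaleModel

variable {Ω : Type*} [MeasurableSpace Ω] {μ : Measure Ω} [IsProbabilityMeasure μ]
  {f : ℝ → ℝ} {V : ℕ → Ω → ℝ}

lemma hasDerivAt_fluct_scale (h : ConvexScaleModel f V μ) (n : ℕ) (v : ℕ → ℝ) (θ : ℝ) :
    HasDerivAt (fun t => fluct n v (fun w => f (w * t)) (∫ ω, f (V 0 ω * t) ∂μ))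
      (fluct n v (fun w => w * deriv f (w * θ)) (∫ ω, V 0 ω * deriv f (V 0 ω * θ) ∂μ)) θ :=
  hasDerivAt_fluct (φ' := fun θ w => w * deriv f (w * θ)) (fun w => h.hasDerivAt_scale w θ)
    (h.hasDerivAt_integral θ) n v

lemma hasDerivAt_fluct_scale_deriv (h : ConvexScaleModel f V μ) (n : ℕ) (v : ℕ → ℝ) (θ : ℝ) :
    HasDerivAt (fun t => fluct n v (fun w => w * deriv f (w * t))
        (∫ ω, V 0 ω * deriv f (V 0 ω * t) ∂μ))
      (fluct n v (fun w => w ^ 2 * iteratedDeriv 2 f (w * θ))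
        (∫ ω, V 0 ω ^ 2 * iteratedDeriv 2 f (V 0 ω * θ) ∂μ)) θ :=
  hasDerivAt_fluct (φ' := fun θ w => w ^ 2 * iteratedDeriv 2 f (w * θ))
    (fun w => h.hasDerivAt_scale_deriv w θ) (h.hasDerivAt_integral_deriv θ) n v

/-- The first derivatives of the fluctuations are bounded in probability, uniformly on `[0, b]`. -/
lemma exists_bound_fluct_deriv (h : ConvexScaleModel f V μ) {b C : ℝ}
    (h1 : MemLp (fun ω => V 0 ω * deriv f (V 0 ω * 0)) 2 μ)
    (h1C : Var[fun ω => V 0 ω * deriv f (V 0 ω * 0); μ] ≤ C)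
    (h2 : ∀ t ∈ Set.Icc 0 b, MemLp (fun ω => V 0 ω ^ 2 * iteratedDeriv 2 f (V 0 ω * t)) 2 μ)
    (h2C : ∀ t ∈ Set.Icc 0 b, Var[fun ω => V 0 ω ^ 2 * iteratedDeriv 2 f (V 0 ω * t); μ] ≤ C)
    {ε : ENNReal} (hε : 0 < ε) :
    ∃ R : ℝ, 0 < R ∧ ∀ n, μ {ω | ∃ θ ∈ Set.Icc 0 b, R < |fluct n (fun j => V j ω)
      (fun w => w * deriv f (w * θ)) (∫ ω, V 0 ω * deriv f (V 0 ω * θ) ∂μ)|} ≤ ε := by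
  have hc1 := h.continuous_deriv
  have hc2 := h.continuous_deriv2
  set X₁ : ℕ → Ω → ℝ → ℝ := fun n ω θ => fluct n (fun j => V j ω)
      (fun w => w * deriv f (w * θ)) (∫ ω, V 0 ω * deriv f (V 0 ω * θ) ∂μ) with hX₁
  set X₂ : ℕ → Ω → ℝ → ℝ := fun n ω θ => fluct n (fun j => V j ω)
      (fun w => w ^ 2 * iteratedDeriv 2 f (w * θ))
      (∫ ω, V 0 ω ^ 2 * iteratedDeriv 2 f (V 0 ω * θ) ∂μ) with hX₂
  have hX₂m (n : ℕ) : Measurable (Function.uncurry (X₂ n)) := by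
    simp only [hX₂, fluct, Function.uncurry_def]
    refine (Finset.measurable_sum _ fun j _ => ?_).const_mul _
    have hm := h.measurable j
    have := hc2.measurable
    have hg := h.continuous_integral_deriv2.measurable
    exact (((hm.comp measurable_fst).pow_const 2).mul
      (this.comp ((hm.comp measurable_fst).mul measurable_snd))).sub (hg.comp measurable_snd)
  have hX₂c (n : ℕ) (ω : Ω) : Continuous (X₂ n ω) := by
    simp only [hX₂, fluct]
    have := h.continuous_integral_deriv2
    fun_prop
  -- By the fundamental theorem of calculus L dominates |X₁| at every point of [0, b]
  -- simultaneously. Its mean is bounded by Tonelli from bounds at fixed t, and Markov's inequality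
  -- concludes.
  set L : ℕ → Ω → ENNReal := fun n ω => ‖X₁ n ω 0‖ₑ + ∫⁻ t in Set.Icc 0 b, ‖X₂ n ω t‖ₑ with hL
  have hX₁m (n : ℕ) : Measurable fun ω => ‖X₁ n ω 0‖ₑ :=
    (measurable_fluct h.measurable (φ := fun w => w * deriv f (w * 0)) (by fun_prop) _ n).enorm
  have hLm (n : ℕ) : Measurable (L n) :=
    (hX₁m n).add ((hX₂m n).enorm.lintegral_prod_right')
  set D : ENNReal := ENNReal.ofReal (1 + C) + ENNReal.ofReal (1 + C) * ENNReal.ofReal b with hD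
  have hLD (n : ℕ) : ∫⁻ ω, L n ω ∂μ ≤ D := by
    rw [lintegral_add_left (hX₁m n)]
    refine add_le_add (lintegral_enorm_fluct_le h.indep h.ident
      (φ := fun w => w * deriv f (w * 0)) (by fun_prop) h1 h1C n) ?_
    rw [lintegral_lintegral_swap (hX₂m n).enorm.aemeasurable]
    calc ∫⁻ t in Set.Icc 0 b, ∫⁻ ω, ‖X₂ n ω t‖ₑ ∂μ
        ≤ ∫⁻ t in Set.Icc 0 b, ENNReal.ofReal (1 + C) :=
          setLIntegral_mono measurable_const fun t ht =>
            lintegral_enorm_fluct_le h.indep h.ident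
              (φ := fun w => w ^ 2 * iteratedDeriv 2 f (w * t)) (by fun_prop)
              (h2 t ht) (h2C t ht) n
      _ = _ := by simp
  have hle (n : ℕ) (ω : Ω) {θ : ℝ} (hθ : θ ∈ Set.Icc 0 b) : ‖X₁ n ω θ‖ₑ ≤ L n ω := by
    have hftc : ∫ t in (0 : ℝ)..θ, X₂ n ω t = X₁ n ω θ - X₁ n ω 0 :=
      intervalIntegral.integral_eq_sub_of_hasDerivAt
        (fun t _ => h.hasDerivAt_fluct_scale_deriv n _ t) ((hX₂c n ω).intervalIntegrable _ _)
    calc ‖X₁ n ω θ‖ₑ = ‖X₁ n ω 0 + ∫ t in (0 : ℝ)..θ, X₂ n ω t‖ₑ := by rw [hftc]; ring_nf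
      _ ≤ ‖X₁ n ω 0‖ₑ + ‖∫ t in (0 : ℝ)..θ, X₂ n ω t‖ₑ := enorm_add_le _ _
      _ ≤ L n ω := by
        refine add_le_add le_rfl ?_
        rw [intervalIntegral.integral_of_le hθ.1]
        refine (enorm_integral_le_lintegral_enorm _).trans (lintegral_mono_set ?_)
        exact fun t ht => ⟨ht.1.le, ht.2.trans hθ.2⟩
  have hDtop : D ≠ ⊤ := by finiteness
  obtain ⟨R, hR0, hR⟩ := exists_forall_measure_le_of_lintegral_le hLm hDtop hLD hε
  refine ⟨R, hR0, fun n => (measure_mono ?_).trans (hR n)⟩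
  rintro ω ⟨θ, hθ, hRθ⟩
  refine le_trans ?_ (hle n ω hθ)
  rw [← ofReal_norm, Real.norm_eq_abs]
  exact ENNReal.ofReal_le_ofReal hRθ.le

end ConvexScaleModel

end RandomRate

namespace RandomRate

/-! ### Functional central limit theorem for the fluctuation paths. -/

section FunctionalCLT

variable {Ω : Type*} [MeasurableSpace Ω] {μ : Measure Ω} [IsProbabilityMeasure μ]
  {V : ℕ → Ω → ℝ} {K : Type*} [TopologicalSpace K]

/-- The path `a ↦ n^{-1/2} ∑_{j < n} (f (v j * σ a) - G a)` as a continuous function of `v`. -/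
noncomputable def fluctPath (f : C(ℝ, ℝ)) (σ G : C(K, ℝ)) (n : ℕ) : C(ℕ → ℝ, C(K, ℝ)) :=
  ContinuousMap.curry ⟨fun p => fluct n p.1 (fun w => f (w * σ p.2)) (G p.2), by
    unfold fluct; fun_prop⟩

lemma fluctPath_apply (f : C(ℝ, ℝ)) (σ G : C(K, ℝ)) (n : ℕ) (v : ℕ → ℝ) (a : K) :
    fluctPath f σ G n v a = fluct n v (fun w => f (w * σ a)) (G a) := rfl

variable [CompactSpace K] [SecondCountableTopology K] [T2Space K]

/-- A finite combination of evaluations of the path is again a normalized sum, that of the i.i.d.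
variables ψ(V_j) with ψ(x) = ∑ c f(x σ(a)), so the one-dimensional theorem supplies every
projection. -/
theorem exists_isGaussianProcess_tendsto_fluctPath (hV : ∀ j, Measurable (V j))
    (hindep : iIndepFun V μ) (hident : ∀ j, IdentDistrib (V j) (V 0) μ μ)
    (f : C(ℝ, ℝ)) (σ G : C(K, ℝ)) (hG : ∀ a, G a = ∫ ω, f (V 0 ω * σ a) ∂μ)
    (hL : ∀ a, MemLp (fun ω => f (V 0 ω * σ a)) 2 μ)
    (htight : IsTightMeasureSet
      (Set.range fun n => μ.map fun ω => fluctPath f σ G n fun j => V j ω)) :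
    ∃ (P : Measure C(K, ℝ)) (_ : IsProbabilityMeasure P),
      IsGaussianProcess (fun (a : K) (x : C(K, ℝ)) => x a) P ∧
      (∀ a, ∫ x, x a ∂P = 0) ∧
      (∀ a a', cov[fun x : C(K, ℝ) => x a, fun x => x a'; P] =
        cov[fun ω => f (V 0 ω * σ a), fun ω => f (V 0 ω * σ a'); μ]) ∧
      TendstoInDistribution (fun n ω => fluctPath f σ G n fun j => V j ω) atTop (fun x => x)
        (fun _ => μ) P := by
  have hVm : Measurable fun ω => fun j => V j ω := measurable_pi_lambda _ hV
  refine exists_isGaussianProcess_tendstoInDistribution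
    (fun n => (fluctPath f σ G n).continuous.measurable.comp hVm) htight hL fun w => ?_
  set ψ : ℝ → ℝ := fun x => w.sum fun a c => c * f (x * σ a) with hψ
  have hψm : Measurable ψ := by
    have : Continuous ψ := by
      simp only [hψ, Finsupp.sum]
      fun_prop
    exact this.measurable
  have hψL : MemLp (fun ω => ψ (V 0 ω)) 2 μ := by
    simp only [hψ, Finsupp.sum]
    exact memLp_finsetSum _ fun a _ => (hL a).const_mul _
  have hmean : ∫ ω, ψ (V 0 ω) ∂μ = w.sum fun a c => c * G a := by
    simp only [hψ, Finsupp.sum]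
    rw [integral_finsetSum _ fun a _ => ((hL a).integrable (by norm_num)).const_mul _]
    simp [integral_const_mul, hG]
  have hclt := tendstoInDistribution_inv_sqrt_mul_sum_sub (P := μ) (X := fun j ω => ψ (V j ω))
    (Y := id) (P' := gaussianReal 0 (Var[fun ω => ψ (V 0 ω); μ]).toNNReal)
    ⟨aemeasurable_id, Measure.map_id⟩ hψL (hindep.comp (fun _ => ψ) fun _ => hψm)
    (fun j => (hident j).comp hψm)
  convert! hclt using 3 with n
  rw [evalComb_apply, hmean]
  simp only [hψ, Finsupp.sum, Function.comp_apply, fluctPath_apply, fluct]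
  rw [Finset.sum_comm, Finset.mul_sum, ← Finset.sum_sub_distrib, Finset.mul_sum]
  refine Finset.sum_congr rfl fun a _ => ?_
  rw [Finset.sum_sub_distrib, ← Finset.mul_sum]
  simp
  ring

end FunctionalCLT

/-! ### The derivatives of g, Ψ_n and X_n, and the saddle point map. -/

namespace ConvexScaleModel

variable {Ω : Type*} [MeasurableSpace Ω] {μ : Measure Ω} {W Z : ℕ → Ω → ℝ}

lemma deriv_empPsi (h : ConvexScaleModel (cgf (Z 0) μ) W μ)
    (n : ℕ) (ω : Ω) (θ : ℝ) : deriv (empPsi W Z μ n ω) θ =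
    empMean n (fun j => W j ω) fun w => w * deriv (cgf (Z 0) μ) (w * θ) :=
  (h.hasDerivAt_empMean_scale n _ θ).deriv

lemma X_eq_fluct (h : ConvexScaleModel (cgf (Z 0) μ) W μ) (n : ℕ) (ω : Ω) : X W Z μ n ω = fun θ =>
    fluct n (fun j => W j ω) (fun w => cgf (Z 0) μ (w * θ)) (∫ ω, cgf (Z 0) μ (W 0 ω * θ) ∂μ) := by
  ext θ
  have hm : Measurable fun w => cgf (Z 0) μ (w * θ) :=
    h.contDiff.continuous.measurable.comp (measurable_id.mul_const θ)
  simp only [X, fluct]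
  congr 1
  exact Finset.sum_congr rfl fun j _ => congrArg _ ((h.ident j).comp hm).integral_eq

variable [IsProbabilityMeasure μ]

lemma deriv_g (h : ConvexScaleModel (cgf (Z 0) μ) W μ) (θ : ℝ) :
    deriv (g W Z μ) θ = ∫ ω, W 0 ω * deriv (cgf (Z 0) μ) (W 0 ω * θ) ∂μ :=
  (h.hasDerivAt_integral θ).deriv

lemma iteratedDeriv_two_g (h : ConvexScaleModel (cgf (Z 0) μ) W μ)
    (θ : ℝ) : iteratedDeriv 2 (g W Z μ) θ =
    ∫ ω, W 0 ω ^ 2 * iteratedDeriv 2 (cgf (Z 0) μ) (W 0 ω * θ) ∂μ := by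
  rw [iteratedDeriv_succ, iteratedDeriv_one, show deriv (g W Z μ) = _ from funext h.deriv_g]
  exact (h.hasDerivAt_integral_deriv θ).deriv

lemma deriv_X (h : ConvexScaleModel (cgf (Z 0) μ) W μ)
    (n : ℕ) (ω : Ω) (θ : ℝ) : deriv (X W Z μ n ω) θ =
    fluct n (fun j => W j ω) (fun w => w * deriv (cgf (Z 0) μ) (w * θ))
      (∫ ω, W 0 ω * deriv (cgf (Z 0) μ) (W 0 ω * θ) ∂μ) := by
  rw [h.X_eq_fluct]
  exact (h.hasDerivAt_fluct_scale n _ θ).deriv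

lemma iteratedDeriv_two_X (h : ConvexScaleModel (cgf (Z 0) μ) W μ)
    (n : ℕ) (ω : Ω) (θ : ℝ) : iteratedDeriv 2 (X W Z μ n ω) θ =
    fluct n (fun j => W j ω) (fun w => w ^ 2 * iteratedDeriv 2 (cgf (Z 0) μ) (w * θ))
      (∫ ω, W 0 ω ^ 2 * iteratedDeriv 2 (cgf (Z 0) μ) (W 0 ω * θ) ∂μ) := by
  rw [iteratedDeriv_succ, iteratedDeriv_one, show deriv (X W Z μ n ω) = _ from
    funext (h.deriv_X n ω)]
  exact (h.hasDerivAt_fluct_scale_deriv n _ θ).deriv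

lemma strictMono_deriv_g (h : ConvexScaleModel (cgf (Z 0) μ) W μ) :
    StrictMono (deriv (g W Z μ)) := by
  rw [show deriv (g W Z μ) = _ from funext h.deriv_g]
  exact h.strictMono_integral_deriv

lemma continuous_deriv_g (h : ConvexScaleModel (cgf (Z 0) μ) W μ) :
    Continuous (deriv (g W Z μ)) := by
  rw [show deriv (g W Z μ) = _ from funext h.deriv_g]
  exact continuous_iff_continuousAt.2 fun θ => (h.hasDerivAt_integral_deriv θ).continuousAt

/-- The left endpoint is g'(0) because f'(0) = E[Z]; strict monotonicity of g' keeps the interval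
nonempty, so its closure is the closed one. -/
lemma Jbar_eq (h : ConvexScaleModel (cgf (Z 0) μ) W μ)
    (hZ : ∀ θ : ℝ, Integrable (fun ω => Real.exp (θ * Z 0 ω)) μ) {θs : ℝ}
    (hθs : 0 < θs) :
    Jbar W Z μ θs = Set.Icc (deriv (g W Z μ) 0) (deriv (g W Z μ) θs) := by
  have h0 : deriv (g W Z μ) 0 = (∫ ω, W 0 ω ∂μ) * ∫ ω, Z 0 ω ∂μ := by
    rw [h.deriv_g]
    simp only [mul_zero]
    rw [integral_mul_const, deriv_cgf_zero (mem_interior_integrableExpSet hZ 0)]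
    simp
  have h1 : deriv (g W Z μ) θs = ∫ ω, W 0 ω * deriv (cgf (Z 0) μ) (θs * W 0 ω) ∂μ := by
    rw [h.deriv_g]
    simp only [mul_comm θs]
  rw [Jbar, ← h0, ← h1, closure_Ioo (h.strictMono_deriv_g hθs).ne]

lemma deriv_g_saddle_of_mem (h : ConvexScaleModel (cgf (Z 0) μ) W μ) {θs a : ℝ} (hθs : 0 < θs)
    (ha : a ∈ Set.Icc (deriv (g W Z μ) 0) (deriv (g W Z μ) θs)) :
    deriv (g W Z μ) (saddle W Z μ a) = a := by
  obtain ⟨θ, -, hθ⟩ := intermediate_value_Icc hθs.le h.continuous_deriv_g.continuousOn ha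
  exact Classical.epsilon_spec (p := fun θ => deriv (g W Z μ) θ = a) ⟨θ, hθ⟩

lemma saddle_mem (h : ConvexScaleModel (cgf (Z 0) μ) W μ) {θs a : ℝ} (hθs : 0 < θs)
    (ha : a ∈ Set.Icc (deriv (g W Z μ) 0) (deriv (g W Z μ) θs)) :
    saddle W Z μ a ∈ Set.Icc 0 θs := by
  have hs := h.deriv_g_saddle_of_mem hθs ha
  rw [← hs] at ha
  exact ⟨h.strictMono_deriv_g.le_iff_le.1 ha.1, h.strictMono_deriv_g.le_iff_le.1 ha.2⟩

lemma exists_saddle_eq (h : ConvexScaleModel (cgf (Z 0) μ) W μ)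
    {θs θ : ℝ} (hθs : 0 < θs) (hθ : θ ∈ Set.Icc 0 θs) :
    ∃ a ∈ Set.Icc (deriv (g W Z μ) 0) (deriv (g W Z μ) θs), saddle W Z μ a = θ := by
  have hm := h.strictMono_deriv_g.monotone
  have ha : deriv (g W Z μ) θ ∈ Set.Icc (deriv (g W Z μ) 0) (deriv (g W Z μ) θs) :=
    ⟨hm hθ.1, hm hθ.2⟩
  exact ⟨_, ha, h.strictMono_deriv_g.injective (h.deriv_g_saddle_of_mem hθs ha)⟩

/-- A continuous strictly increasing function on the line is an embedding, and `saddle` inverts g'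
on J̄. -/
lemma continuous_saddle (h : ConvexScaleModel (cgf (Z 0) μ) W μ) {θs : ℝ} (hθs : 0 < θs) {J : Set ℝ}
    (hJ : J = Set.Icc (deriv (g W Z μ) 0) (deriv (g W Z μ) θs)) :
    Continuous fun a : J => saddle W Z μ a := by
  have : (Set.range (deriv (g W Z μ))).OrdConnected :=
    (isPreconnected_range h.continuous_deriv_g).ordConnected
  rw [(h.strictMono_deriv_g.isEmbedding_of_ordConnected this).isInducing.continuous_iff]
  refine continuous_subtype_val.congr fun a => ?_
  exact (h.deriv_g_saddle_of_mem hθs (hJ ▸ a.2)).symm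

end ConvexScaleModel

end RandomRate

namespace RandomRate

/-! ### Expansion of the random rate function. -/

namespace ConvexScaleModel

variable {Ω : Type*} [MeasurableSpace Ω] {μ : Measure Ω} {W Z : ℕ → Ω → ℝ}

/-- The points -1 and θs + 1 lie strictly outside [0, θs], leaving room for the strict inequalities
that the law of large numbers eventually provides. They bracket all slopes in J̄ at once. -/
lemma existsUnique_deriv_empPsi_eq (h : ConvexScaleModel (cgf (Z 0) μ) W μ) {θs : ℝ}
    (hθs : 0 < θs) {n : ℕ} {ω : Ω} {t : ℝ}
    (hpos : 0 < empMean n (fun j => W j ω) fun w => w ^ 2 * iteratedDeriv 2 (cgf (Z 0) μ) (w * t))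
    (hlo : (empMean n (fun j => W j ω) fun w => w * deriv (cgf (Z 0) μ) (w * (-1)))
      < deriv (g W Z μ) 0)
    (hhi : deriv (g W Z μ) θs
      < empMean n (fun j => W j ω) fun w => w * deriv (cgf (Z 0) μ) (w * (θs + 1)))
    {a : ℝ} (ha : a ∈ Set.Icc (deriv (g W Z μ) 0) (deriv (g W Z μ) θs)) :
    ∃! θ, deriv (empPsi W Z μ n ω) θ = a := by
  simp only [h.deriv_empPsi]
  have hcont : Continuous fun θ =>
      empMean n (fun j => W j ω) fun w => w * deriv (cgf (Z 0) μ) (w * θ) :=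
    continuous_iff_continuousAt.2 fun θ => (h.hasDerivAt_empMean_scale_deriv n _ θ).continuousAt
  obtain ⟨θ, -, hθ⟩ := intermediate_value_Icc (by linarith : (-1 : ℝ) ≤ θs + 1)
    hcont.continuousOn ⟨hlo.le.trans ha.1, ha.2.trans hhi.le⟩
  exact ⟨θ, hθ, fun θ' hθ' =>
    (h.strictMono_empMean_scale_deriv hpos).injective (hθ'.trans hθ.symm)⟩

variable [IsProbabilityMeasure μ]

/-- The remainder, multiplied by `n`, in the first order expansion of the random rate function. -/
lemma abs_expansion_remainder_le (h : ConvexScaleModel (cgf (Z 0) μ) W μ) {θs : ℝ} (hθs : 0 < θs)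
    {n : ℕ} (hn : 1 ≤ n) {ω : Ω} {δ η m R a : ℝ} (hδ : 0 < δ) (hm : 0 < m)
    (hηm : 4 * η ≤ m) (ha : a ∈ Set.Icc (deriv (g W Z μ) 0) (deriv (g W Z μ) θs))
    (hη : ∀ t, |t - saddle W Z μ a| ≤ δ →
      |(empMean n (fun j => W j ω) fun w => w ^ 2 * iteratedDeriv 2 (cgf (Z 0) μ) (w * t)) -
        (empMean n (fun j => W j ω) fun w =>
          w ^ 2 * iteratedDeriv 2 (cgf (Z 0) μ) (w * saddle W Z μ a))| ≤ η)
    (hlow : m ≤ empMean n (fun j => W j ω) fun w =>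
      w ^ 2 * iteratedDeriv 2 (cgf (Z 0) μ) (w * saddle W Z μ a))
    (hX : |deriv (X W Z μ n ω) (saddle W Z μ a)| ≤ R)
    (hnR : 2 * (1 / √(n : ℝ) * R) ≤ m * δ)
    (hex : ∃ θ, deriv (empPsi W Z μ n ω) θ = a) :
    |n * (empRate W Z μ n ω a - rate W Z μ a
          + 1 / √(n : ℝ) * X W Z μ n ω (saddle W Z μ a))
      - deriv (X W Z μ n ω) (saddle W Z μ a) ^ 2 /
          (2 * (iteratedDeriv 2 (g W Z μ) (saddle W Z μ a) +
            1 / √(n : ℝ) * iteratedDeriv 2 (X W Z μ n ω) (saddle W Z μ a)))|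
      ≤ 2 * η * R ^ 2 / m ^ 2 := by
  set θ := saddle W Z μ a with hθ
  set t := empSaddle W Z μ n ω a with ht
  have hn0 : (0 : ℝ) < n := by exact_mod_cast hn
  have hs0 : 0 < √(n : ℝ) := Real.sqrt_pos.2 hn0
  have hs : √(n : ℝ) ^ 2 = n := Real.sq_sqrt hn0.le
  have hη0 : 0 ≤ η := (abs_nonneg _).trans (hη θ (by simpa using hδ.le))
  have htt : deriv (empPsi W Z μ n ω) t = a := Classical.epsilon_spec hex
  rw [h.deriv_empPsi] at htt
  have e0 : empPsi W Z μ n ω θ = g W Z μ θ + 1 / √(n : ℝ) * X W Z μ n ω θ := by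
    rw [h.X_eq_fluct]
    exact empMean_eq_add_fluct hn _ _ _
  -- The slope defect a - Ψ_n'(θ) is exactly -n^{-1/2} X_n'(θ); this is what makes the quadratic
  -- term of order 1/n.
  have e1 : (empMean n (fun j => W j ω) fun w => w * deriv (cgf (Z 0) μ) (w * θ))
      = a + 1 / √(n : ℝ) * deriv (X W Z μ n ω) θ := by
    rw [h.deriv_X, empMean_eq_add_fluct hn _ _ _, ← h.deriv_g,
      h.deriv_g_saddle_of_mem hθs ha]
  have e2 : (empMean n (fun j => W j ω) fun w => w ^ 2 * iteratedDeriv 2 (cgf (Z 0) μ) (w * θ))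
      = iteratedDeriv 2 (g W Z μ) θ + 1 / √(n : ℝ) * iteratedDeriv 2 (X W Z μ n ω) θ := by
    rw [h.iteratedDeriv_two_X, empMean_eq_add_fluct hn _ _ _, ← h.iteratedDeriv_two_g]
  have hb : |a - (empMean n (fun j => W j ω) fun w => w * deriv (cgf (Z 0) μ) (w * θ))|
      = 1 / √(n : ℝ) * |deriv (X W Z μ n ω) θ| := by
    rw [e1, sub_add_cancel_left, abs_neg, abs_mul, abs_of_pos (by positivity)]
  have key := abs_legendre_expansion_le (h.hasDerivAt_empMean_scale n fun j => W j ω)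
    (h.hasDerivAt_empMean_scale_deriv n _)
    (h.strictMono_empMean_scale_deriv (hm.trans_le hlow)) hδ hm hηm hη hlow
    (by rw [hb]; refine le_trans ?_ hnR; gcongr) htt
  change |a * t - empPsi W Z μ n ω t - (a * θ - empPsi W Z μ n ω θ) - _| ≤ _ at key
  rw [← sq_abs (a - _), hb, mul_pow, div_pow, one_pow, hs, sq_abs, e2, e0] at key
  have hXsq : deriv (X W Z μ n ω) θ ^ 2 ≤ R ^ 2 := by
    rw [← sq_abs]; exact pow_le_pow_left₀ (abs_nonneg _) hX 2
  set D := 2 * (iteratedDeriv 2 (g W Z μ) θ + 1 / √(n : ℝ) * iteratedDeriv 2 (X W Z μ n ω) θ)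
  have hrw : n * (empRate W Z μ n ω a - rate W Z μ a + 1 / √(n : ℝ) * X W Z μ n ω θ)
      - deriv (X W Z μ n ω) θ ^ 2 / D
      = n * (a * t - empPsi W Z μ n ω t - (a * θ - (g W Z μ θ + 1 / √(n : ℝ) * X W Z μ n ω θ))
        - 1 / (n : ℝ) * deriv (X W Z μ n ω) θ ^ 2 / D) := by
    simp only [empRate, rate, ← hθ, ← ht]
    field_simp
    ring
  rw [hrw, abs_mul, abs_of_pos hn0]
  calc _ ≤ n * (2 * η * (1 / (n : ℝ) * deriv (X W Z μ n ω) θ ^ 2) / m ^ 2) := by gcongr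
    _ = 2 * η * deriv (X W Z μ n ω) θ ^ 2 / m ^ 2 := by field_simp
    _ ≤ _ := by gcongr

lemma ae_eventually_existsUnique (h : ConvexScaleModel (cgf (Z 0) μ) W μ) {θs : ℝ}
    (hθs : 0 < θs) :
    ∀ᵐ ω ∂μ, ∀ᶠ n : ℕ in atTop, ∀ a ∈ Set.Icc (deriv (g W Z μ) 0) (deriv (g W Z μ) θs),
      ∃! θ, deriv (empPsi W Z μ n ω) θ = a := by
  have hc1 := h.continuous_deriv
  have hc2 := h.continuous_deriv2
  have hm1 (θ : ℝ) : Measurable fun w => w * deriv (cgf (Z 0) μ) (w * θ) := by fun_prop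
  have hm2 (θ : ℝ) : Measurable fun w => w ^ 2 * iteratedDeriv 2 (cgf (Z 0) μ) (w * θ) := by
    fun_prop
  filter_upwards [ae_tendsto_empMean h.indep h.ident (hm1 (-1)) (h.integrable_scale_deriv _),
    ae_tendsto_empMean h.indep h.ident (hm1 (θs + 1)) (h.integrable_scale_deriv _),
    ae_tendsto_empMean h.indep h.ident (hm2 0) (h.integrable_scale_deriv2 _)] with ω h1 h2 h3
  have hlo := h.strictMono_deriv_g (by norm_num : (-1 : ℝ) < 0)
  have hhi := h.strictMono_deriv_g (lt_add_one θs)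
  rw [h.deriv_g (-1)] at hlo
  rw [h.deriv_g (θs + 1)] at hhi
  filter_upwards [h1.eventually_lt_const hlo, h2.eventually_const_lt hhi,
    h3.eventually_const_lt (h.integral_deriv2_pos 0)] with n hn1 hn2 hn3 a ha
  exact h.existsUnique_deriv_empPsi_eq hθs hn3 hn1 hn2 ha

/-- The expansion of the random rate function, with an error that is uniformly small in
probability, given a uniform bound in probability of `X_n'`. -/
lemma tendsto_measure_expansion (h : ConvexScaleModel (cgf (Z 0) μ) W μ) {θs : ℝ} (hθs : 0 < θs)
    (hR : ∀ ε : ENNReal, 0 < ε → ∃ R : ℝ, 0 < R ∧ ∀ n,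
      μ {ω | ∃ θ ∈ Set.Icc 0 θs, R < |deriv (X W Z μ n ω) θ|} ≤ ε) {ε : ℝ} (hε : 0 < ε) :
    Tendsto (fun n : ℕ => μ {ω | ∃ a ∈ Set.Icc (deriv (g W Z μ) 0) (deriv (g W Z μ) θs),
      ε < |n * (empRate W Z μ n ω a - rate W Z μ a
          + 1 / √(n : ℝ) * X W Z μ n ω (saddle W Z μ a))
        - deriv (X W Z μ n ω) (saddle W Z μ a) ^ 2 /
          (2 * (iteratedDeriv 2 (g W Z μ) (saddle W Z μ a) +
            1 / √(n : ℝ) * iteratedDeriv 2 (X W Z μ n ω) (saddle W Z μ a)))|})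
      atTop (𝓝 0) := by
  rw [ENNReal.tendsto_nhds_zero]
  intro ε' hε'
  obtain ⟨R, hR0, hR⟩ := hR (ε' / 2) (ENNReal.half_pos hε'.ne')
  obtain ⟨φ, hφm, hφi, hφpos, hφ⟩ := h.exists_minorant_deriv2 (θs + 1)
  set m := (∫ ω, φ (W 0 ω) ∂μ) / 2 with hmdef
  have hm : 0 < m := half_pos hφpos
  -- R and m are fixed before η. The first entry is the smallness required by the Legendre
  -- expansion; the second makes the final error 2ηR²/m² at most ε.
  set η := min (m / 4) (ε * m ^ 2 / (2 * R ^ 2)) with hηdef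
  have hη : 0 < η := by positivity
  have hη1 : 4 * η ≤ m := by linarith [min_le_left (m / 4) (ε * m ^ 2 / (2 * R ^ 2))]
  have hη2 : 2 * η * R ^ 2 / m ^ 2 ≤ ε := by
    have := min_le_right (m / 4) (ε * m ^ 2 / (2 * R ^ 2))
    rw [← hηdef, le_div_iff₀ (by positivity)] at this
    rw [div_le_iff₀ (by positivity)]
    linarith
  obtain ⟨δ', hδ', ψ, hψm, hψi, hψη, hψ⟩ := h.exists_modulus_deriv2 (θs + 1) hη
  -- The cap at 1 keeps the δ-neighbourhood of a saddle point in [0, θs] inside the ball of radius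
  -- θs + 1, where the modulus ψ is valid.
  set δ := min δ' 1 with hδdef
  have hδ : 0 < δ := by positivity
  have hc1 := h.continuous_deriv
  have hm1 (θ : ℝ) : Measurable fun w => w * deriv (cgf (Z 0) μ) (w * θ) := by fun_prop
  have hVm := h.measurable
  let A : ℕ → Set Ω := fun n =>
    ({ω | m < empMean n (fun j => W j ω) φ} ∩ {ω | empMean n (fun j => W j ω) ψ < η}) ∩
    ({ω | (empMean n (fun j => W j ω) fun w => w * deriv (cgf (Z 0) μ) (w * (-1)))
      < deriv (g W Z μ) 0} ∩
    {ω | deriv (g W Z μ) θs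
      < empMean n (fun j => W j ω) fun w => w * deriv (cgf (Z 0) μ) (w * (θs + 1))})
  have hAm (n : ℕ) : MeasurableSet (A n) :=
    ((measurableSet_lt measurable_const (measurable_empMean hVm hφm n)).inter
      (measurableSet_lt (measurable_empMean hVm hψm n) measurable_const)).inter
    ((measurableSet_lt (measurable_empMean hVm (hm1 _) n) measurable_const).inter
      (measurableSet_lt measurable_const (measurable_empMean hVm (hm1 _) n)))
  have hA : ∀ᵐ ω ∂μ, ∀ᶠ n in atTop, ω ∈ A n := by
    filter_upwards [ae_tendsto_empMean h.indep h.ident (hm1 (-1)) (h.integrable_scale_deriv _),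
      ae_tendsto_empMean h.indep h.ident (hm1 (θs + 1)) (h.integrable_scale_deriv _),
      ae_tendsto_empMean h.indep h.ident hφm hφi,
      ae_tendsto_empMean h.indep h.ident hψm hψi] with ω h1 h2 h3 h4
    have hlo := h.strictMono_deriv_g (by norm_num : (-1 : ℝ) < 0)
    have hhi := h.strictMono_deriv_g (lt_add_one θs)
    rw [h.deriv_g (-1)] at hlo
    rw [h.deriv_g (θs + 1)] at hhi
    filter_upwards [h1.eventually_lt_const hlo, h2.eventually_const_lt hhi,
      h3.eventually_const_lt (half_lt_self hφpos), h4.eventually_lt_const hψη]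
      with n hn1 hn2 hn3 hn4
    exact ⟨⟨hn3, hn4⟩, hn1, hn2⟩
  have hAlim := tendsto_measure_compl_of_ae_eventually_mem hAm hA
  have hnlim : Tendsto (fun n : ℕ => 2 * (1 / √(n : ℝ) * R)) atTop (𝓝 0) := by
    have : Tendsto (fun n : ℕ => 1 / √(n : ℝ)) atTop (𝓝 0) :=
      tendsto_const_nhds.div_atTop (Real.tendsto_sqrt_atTop.comp tendsto_natCast_atTop_atTop)
    simpa using (this.mul_const R).const_mul 2
  filter_upwards [ENNReal.tendsto_nhds_zero.1 hAlim (ε' / 2) (ENNReal.half_pos hε'.ne'),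
    hnlim.eventually_lt_const (by positivity : 0 < m * δ), eventually_ge_atTop 1]
    with n hnA hnR hn1
  -- The exceptional set is a union over uncountably many a and is not claimed measurable;
  -- monotonicity of the outer measure is enough.
  refine (measure_mono ?_).trans ((measure_union_le (A n)ᶜ
    {ω | ∃ θ ∈ Set.Icc 0 θs, R < |deriv (X W Z μ n ω) θ|}).trans
    ((add_le_add hnA (hR n)).trans (ENNReal.add_halves ε').le))
  rintro ω ⟨a, ha, hεa⟩
  by_contra hω
  rw [Set.mem_union, not_or, Set.notMem_compl_iff] at hω
  obtain ⟨⟨⟨hA1, hA2⟩, hA3, hA4⟩, hXR⟩ := hω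
  have hXR' : ∀ θ ∈ Set.Icc 0 θs, |deriv (X W Z μ n ω) θ| ≤ R := by
    simpa using hXR
  have hσ := h.saddle_mem hθs ha
  have hσ1 : |saddle W Z μ a| ≤ θs + 1 := by
    rw [abs_of_nonneg hσ.1]; linarith [hσ.2]
  have hlow : m ≤ empMean n (fun j => W j ω) fun w =>
      w ^ 2 * iteratedDeriv 2 (cgf (Z 0) μ) (w * saddle W Z μ a) :=
    hA1.le.trans (empMean_mono fun w => hφ w _ hσ1)
  refine absurd hεa (not_lt.2 (le_trans ?_ hη2))
  refine h.abs_expansion_remainder_le hθs hn1 hδ hm hη1 ha ?_ hlow (hXR' _ hσ) hnR.le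
    (h.existsUnique_deriv_empPsi_eq hθs (hm.trans_le hlow) hA3 hA4 ha).exists
  intro t ht
  have ht1 : |t| ≤ θs + 1 := by
    have h1 := abs_le.1 (ht.trans (min_le_right _ _))
    rw [abs_le]
    constructor <;> linarith [hσ.1, hσ.2]
  rw [empMean_sub]
  exact ((abs_empMean_le _ _ _).trans (empMean_mono fun w =>
    hψ w t _ ht1 hσ1 (ht.trans (min_le_left _ _)))).trans hA2.le

end ConvexScaleModel

end RandomRate

namespace RandomRate

variable {Ω : Type*} [MeasurableSpace Ω] {μ : Measure Ω} {W Z : ℕ → Ω → ℝ}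

lemma Jbar_eq_empty {θs : ℝ} (hW : ∀ᵐ ω ∂μ, W 0 ω = 0) : Jbar W Z μ θs = ∅ := by
  have h1 : ∫ ω, W 0 ω ∂μ = 0 := integral_eq_zero_of_ae hW
  have h2 : ∫ ω, W 0 ω * deriv (cgf (Z 0) μ) (θs * W 0 ω) ∂μ = 0 :=
    integral_eq_zero_of_ae (hW.mono fun ω hω => by simp [hω])
  simp [Jbar, h1, h2]

variable [IsProbabilityMeasure μ]

/-! ### From the covariance assumption to the limit theorem. -/

namespace ConvexScaleModel

/-- Every θ in [0, θs] is a saddle point of some a in J̄, so assumptions indexed by a transfer to θ.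
-/
lemma memLp_of_covAssumption (h : ConvexScaleModel (cgf (Z 0) μ) W μ) {θs : ℝ} (hθs : 0 < θs)
    (hJ : Jbar W Z μ θs = Set.Icc (deriv (g W Z μ) 0) (deriv (g W Z μ) θs))
    (hCov : CovAssumption W Z μ θs) {k : ℕ} (hk : k ≤ 3) {θ : ℝ} (hθ : θ ∈ Set.Icc 0 θs) :
    MemLp (fun ω => W 0 ω ^ k * iteratedDeriv k (cgf (Z 0) μ) (W 0 ω * θ)) 2 μ := by
  obtain ⟨a, ha, rfl⟩ := h.exists_saddle_eq hθs hθ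
  convert! hCov.memLp a (hJ ▸ ha) k hk using 2 with ω
  rw [Y, mul_comm (saddle W Z μ a)]

lemma exists_variance_le_of_covAssumption (h : ConvexScaleModel (cgf (Z 0) μ) W μ) {θs : ℝ}
    (hθs : 0 < θs) (hJ : Jbar W Z μ θs = Set.Icc (deriv (g W Z μ) 0) (deriv (g W Z μ) θs))
    (hCov : CovAssumption W Z μ θs) :
    ∃ C : ℝ, ∀ k ≤ 2, ∀ θ ∈ Set.Icc 0 θs,
      Var[fun ω => W 0 ω ^ k * iteratedDeriv k (cgf (Z 0) μ) (W 0 ω * θ); μ] ≤ C := by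
  obtain ⟨C, hC⟩ := hCov.bound
  refine ⟨C, fun k hk θ hθ => ?_⟩
  obtain ⟨a, ha, rfl⟩ := h.exists_saddle_eq hθs hθ
  have haJ : a ∈ Jbar W Z μ θs := hJ ▸ ha
  obtain ⟨h0, h1, h2, -⟩ := hC a haJ a haJ
  have hY : (fun ω => W 0 ω ^ k * iteratedDeriv k (cgf (Z 0) μ) (W 0 ω * saddle W Z μ a))
      = Y W Z μ k a := by
    ext ω
    rw [Y, mul_comm (saddle W Z μ a)]
  rw [hY, ← covariance_self (hCov.memLp a haJ k (by omega)).aestronglyMeasurable.aemeasurable]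
  interval_cases k
  exacts [h0.le, h1.le, h2.le]

lemma exists_bound_deriv_X (h : ConvexScaleModel (cgf (Z 0) μ) W μ) {θs : ℝ} (hθs : 0 < θs)
    (hJ : Jbar W Z μ θs = Set.Icc (deriv (g W Z μ) 0) (deriv (g W Z μ) θs))
    (hCov : CovAssumption W Z μ θs) (ε : ENNReal) (hε : 0 < ε) :
    ∃ R : ℝ, 0 < R ∧ ∀ n,
      μ {ω | ∃ θ ∈ Set.Icc 0 θs, R < |deriv (X W Z μ n ω) θ|} ≤ ε := by
  obtain ⟨C, hC⟩ := h.exists_variance_le_of_covAssumption hθs hJ hCov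
  have h0 : (0 : ℝ) ∈ Set.Icc 0 θs := ⟨le_rfl, hθs.le⟩
  have h1 := h.memLp_of_covAssumption hθs hJ hCov (k := 1) (by norm_num) h0
  have h1C := hC 1 (by norm_num) 0 h0
  simp only [pow_one, iteratedDeriv_one] at h1 h1C
  simp only [h.deriv_X]
  exact h.exists_bound_fluct_deriv h1 h1C
    (fun t ht => h.memLp_of_covAssumption hθs hJ hCov (by norm_num) ht)
    (fun t ht => hC 2 le_rfl t ht) hε

/-- The functional central limit theorem for `(X_n(ϑ(a)))`. -/
lemma exists_isGaussianProcess_tendsto_X (h : ConvexScaleModel (cgf (Z 0) μ) W μ) {θs : ℝ}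
    (hθs : 0 < θs) (hJ : Jbar W Z μ θs = Set.Icc (deriv (g W Z μ) 0) (deriv (g W Z μ) θs))
    (hCov : CovAssumption W Z μ θs) :
    ∃ (Xc : ℕ → Ω → C(Jbar W Z μ θs, ℝ)) (P : Measure C(Jbar W Z μ θs, ℝ))
      (_ : IsProbabilityMeasure P),
      (∀ n ω a, Xc n ω a = X W Z μ n ω (saddle W Z μ a)) ∧
      IsGaussianProcess (fun (a : Jbar W Z μ θs) (x : C(Jbar W Z μ θs, ℝ)) => x a) P ∧
      (∀ a : Jbar W Z μ θs, ∫ x, x a ∂P = 0) ∧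
      (∀ a a' : Jbar W Z μ θs,
        cov[fun x : C(Jbar W Z μ θs, ℝ) => x a, fun x => x a'; P] =
          (∫ ω, cgf (Z 0) μ (W 0 ω * saddle W Z μ a) *
              cgf (Z 0) μ (W 0 ω * saddle W Z μ a') ∂μ) -
            (∫ ω, cgf (Z 0) μ (W 0 ω * saddle W Z μ a) ∂μ) *
              ∫ ω, cgf (Z 0) μ (W 0 ω * saddle W Z μ a') ∂μ) ∧
      TendstoInDistribution Xc atTop (fun x => x) (fun _ => μ) P := by
  set K := Jbar W Z μ θs
  have hcK : CompactSpace K := isCompact_iff_compactSpace.1 (hJ ▸ isCompact_Icc)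
  let f : C(ℝ, ℝ) := ⟨cgf (Z 0) μ, h.contDiff.continuous⟩
  let σ : C(K, ℝ) := ⟨fun a => saddle W Z μ a, h.continuous_saddle hθs hJ⟩
  have hgc : Continuous (g W Z μ) :=
    continuous_iff_continuousAt.2 fun θ => (h.hasDerivAt_integral θ).continuousAt
  let G : C(K, ℝ) := ⟨fun a => g W Z μ (σ a), hgc.comp σ.continuous⟩
  have hσ (a : K) : σ a ∈ Set.Icc 0 θs := h.saddle_mem hθs (hJ ▸ a.2)
  have hL {θ : ℝ} (hθ : θ ∈ Set.Icc 0 θs) : MemLp (fun ω => cgf (Z 0) μ (W 0 ω * θ)) 2 μ := by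
    simpa using h.memLp_of_covAssumption hθs hJ hCov (k := 0) (by norm_num) hθ
  have hpath (n : ℕ) (ω : Ω) (a : K) : fluctPath f σ G n (fun j => W j ω) a
      = X W Z μ n ω (saddle W Z μ a) := by
    rw [h.X_eq_fluct]; rfl
  have hWm : Measurable fun ω => fun j => W j ω := measurable_pi_lambda _ h.measurable
  have htight : IsTightMeasureSet
      (Set.range fun n => μ.map fun ω => fluctPath f σ G n fun j => W j ω) := by
    have ha₀ : deriv (g W Z μ) 0 ∈ K := by
      rw [hJ]
      exact ⟨le_rfl, h.strictMono_deriv_g.monotone hθs.le⟩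
    set a₀ : K := ⟨_, ha₀⟩
    refine isTightMeasureSet_range_map_of_lipschitz
      (fun n => (fluctPath f σ G n).continuous.measurable.comp hWm) σ.continuous a₀ fun ε hε => ?_
    have hε2 : 0 < ε / 2 := ENNReal.half_pos hε.ne'
    obtain ⟨R₁, hR₁, h₁⟩ := h.exists_bound_deriv_X hθs hJ hCov (ε / 2) hε2
    have hfm : Measurable fun w => cgf (Z 0) μ (w * σ a₀) :=
      f.continuous.measurable.comp (measurable_id.mul_const _)
    obtain ⟨R₂, hR₂, h₂⟩ := exists_forall_measure_le_of_lintegral_le (μ := μ)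
      (fun n => (measurable_fluct h.measurable hfm (G a₀) n).enorm) ENNReal.ofReal_ne_top
      (lintegral_enorm_fluct_le h.indep h.ident hfm (hL (hσ a₀)) le_rfl) hε2
    refine ⟨max R₁ R₂, fun n => (measure_mono ?_).trans ((measure_union_le _ _).trans
      ((add_le_add (h₁ n) (h₂ n)).trans (ENNReal.add_halves ε).le))⟩
    intro ω hω
    by_contra hgood
    rw [Set.mem_union, not_or] at hgood
    obtain ⟨hg1, hg2⟩ := hgood
    have hg1' : ∀ θ ∈ Set.Icc 0 θs, |deriv (X W Z μ n ω) θ| ≤ R₁ := by simpa using hg1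
    -- On the good event, the mean value inequality on [0, θs] turns the bound on X_n' into a
    -- Lipschitz bound in ϑ(a), the pseudo-distance of the tightness criterion.
    refine hω ⟨?_, fun a b => ?_⟩
    · have hg2' : ‖fluctPath f σ G n (fun j => W j ω) a₀‖ₑ < ENNReal.ofReal R₂ := not_le.1 hg2
      rw [← ofReal_norm, ENNReal.ofReal_lt_ofReal_iff hR₂] at hg2'
      exact hg2'.le.trans (le_max_right _ _)
    · rw [hpath, hpath]
      have hd : ∀ θ ∈ Set.Icc 0 θs, HasDerivWithinAt (X W Z μ n ω) (deriv (X W Z μ n ω) θ)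
          (Set.Icc 0 θs) θ := by
        intro θ _
        rw [h.deriv_X, h.X_eq_fluct]
        exact (h.hasDerivAt_fluct_scale n _ θ).hasDerivWithinAt
      have := (convex_Icc 0 θs).norm_image_sub_le_of_norm_hasDerivWithin_le hd hg1' (hσ b) (hσ a)
      exact this.trans (mul_le_mul_of_nonneg_right (le_max_left _ _) (norm_nonneg _))
  obtain ⟨P, hP, hgauss, hmean, hcov, hlim⟩ := exists_isGaussianProcess_tendsto_fluctPath
    h.measurable h.indep h.ident f σ G (fun a => rfl) (fun a => hL (hσ a)) htight
  refine ⟨_, P, hP, hpath, hgauss, hmean, fun a a' => ?_, hlim⟩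
  exact (hcov a a').trans (covariance_eq_sub (hL (hσ a)) (hL (hσ a')))

end ConvexScaleModel

/-- The functional central limit theorem over an empty index set. -/
lemma exists_tendstoInDistribution_of_isEmpty {K : Type*} [TopologicalSpace K] [IsEmpty K] :
    ∃ (Xc : ℕ → Ω → C(K, ℝ)) (P : Measure C(K, ℝ)) (_ : IsProbabilityMeasure P),
      IsGaussianProcess (fun (a : K) (x : C(K, ℝ)) => x a) P ∧
      TendstoInDistribution Xc atTop (fun x => x) (fun _ => μ) P := by
  refine ⟨fun _ _ => 0, Measure.dirac 0, inferInstance, ⟨fun I => ⟨?_⟩⟩,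
    ⟨fun _ => aemeasurable_const, aemeasurable_id, ?_⟩⟩
  · have hm : Measurable fun x : C(K, ℝ) => I.restrict fun a => x a :=
      measurable_pi_lambda _ fun i => isEmptyElim (i : K)
    rw [Measure.map_dirac' hm]
    infer_instance
  · refine tendsto_const_nhds.congr fun n => Subtype.ext ?_
    simp [Measure.map_const]

end RandomRate

theorem theorem3 {Ω : Type*} [MeasurableSpace Ω] (μ : Measure Ω) [IsProbabilityMeasure μ]
    (W Z : ℕ → Ω → ℝ) (hmodel : RandomRate.IsModel W Z μ)
    (hLD : RandomRate.LDConditions (W 0) (Z 0) μ)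
    (θs : ℝ) (hθs : 0 < θs)
    (hcurv : ∃ c : ℝ, 0 < c ∧ ∀ a ∈ RandomRate.Jbar W Z μ θs,
      c < iteratedDeriv 2 (RandomRate.g W Z μ) (RandomRate.saddle W Z μ a))
    (hCov : RandomRate.CovAssumption W Z μ θs) :
    -- the saddle points `ϑ(a)` and (almost surely, for large `n`) `ϑ_n(a)` are well defined
    (∀ a ∈ RandomRate.Jbar W Z μ θs, ∃! θ : ℝ, deriv (RandomRate.g W Z μ) θ = a) ∧
    (∀ᵐ ω ∂μ, ∀ᶠ n : ℕ in atTop, ∀ a ∈ RandomRate.Jbar W Z μ θs,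
      ∃! θ : ℝ, deriv (RandomRate.empPsi W Z μ n ω) θ = a) ∧
    -- expansion of the random rate function, the `o(1)` being in probability, uniformly in `a`
    (∃ r : ℕ → Ω → ℝ → ℝ,
      (∀ n : ℕ, 1 ≤ n → ∀ ω, ∀ a ∈ RandomRate.Jbar W Z μ θs,
        RandomRate.empRate W Z μ n ω a =
          RandomRate.rate W Z μ a
            - (1 / √(n : ℝ)) * RandomRate.X W Z μ n ω (RandomRate.saddle W Z μ a)
            + (1 / (n : ℝ)) * r n ω a) ∧
      ∀ ε : ℝ, 0 < ε →
        Tendsto (fun n : ℕ => μ {ω | ∃ a ∈ RandomRate.Jbar W Z μ θs,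
          ε < |r n ω a -
            (deriv (RandomRate.X W Z μ n ω) (RandomRate.saddle W Z μ a)) ^ 2 /
              (2 * (iteratedDeriv 2 (RandomRate.g W Z μ) (RandomRate.saddle W Z μ a) +
                (1 / √(n : ℝ)) *
                  iteratedDeriv 2 (RandomRate.X W Z μ n ω) (RandomRate.saddle W Z μ a)))|})
          atTop (𝓝 0)) ∧
    -- functional central limit theorem in `C(J̄)`
    (∃ (Xc : ℕ → Ω → C(RandomRate.Jbar W Z μ θs, ℝ))
        (P : Measure C(RandomRate.Jbar W Z μ θs, ℝ)) (_ : IsProbabilityMeasure P),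
      (∀ n ω a, Xc n ω a = RandomRate.X W Z μ n ω (RandomRate.saddle W Z μ a)) ∧
      IsGaussianProcess (fun (a : RandomRate.Jbar W Z μ θs)
        (x : C(RandomRate.Jbar W Z μ θs, ℝ)) => x a) P ∧
      (∀ a : RandomRate.Jbar W Z μ θs, ∫ x, x a ∂P = 0) ∧
      (∀ a a' : RandomRate.Jbar W Z μ θs,
        cov[fun x : C(RandomRate.Jbar W Z μ θs, ℝ) => x a, fun x => x a'; P] =
          (∫ ω, cgf (Z 0) μ (W 0 ω * RandomRate.saddle W Z μ a) *
              cgf (Z 0) μ (W 0 ω * RandomRate.saddle W Z μ a') ∂μ) -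
            (∫ ω, cgf (Z 0) μ (W 0 ω * RandomRate.saddle W Z μ a) ∂μ) *
              ∫ ω, cgf (Z 0) μ (W 0 ω * RandomRate.saddle W Z μ a') ∂μ) ∧
      TendstoInDistribution Xc atTop (fun x => x) (fun _ => μ) P) := by
  have hmgf := hLD.mgf_finite
  -- If `W 0` vanishes almost surely, both endpoints of J are 0 and J̄ is empty; only a law on the
  -- one-point space of functions on the empty set has to be exhibited.
  by_cases hW : ∀ᵐ ω ∂μ, W 0 ω = 0
  · have hJ : RandomRate.Jbar W Z μ θs = ∅ := RandomRate.Jbar_eq_empty hW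
    have hE : IsEmpty (RandomRate.Jbar W Z μ θs) := by
      rw [hJ]; infer_instance
    have hno : ∀ a, a ∉ RandomRate.Jbar W Z μ θs := fun a ha => hE.false ⟨a, ha⟩
    refine ⟨fun a ha => (hno a ha).elim,
      Eventually.of_forall fun ω => Eventually.of_forall fun n a ha => (hno a ha).elim,
      ⟨fun _ _ _ => 0, fun n _ ω a ha => (hno a ha).elim, fun ε _ => ?_⟩, ?_⟩
    · simp [hno]
    · obtain ⟨Xc, P, hP, hgauss, hlim⟩ :=
        RandomRate.exists_tendstoInDistribution_of_isEmpty (μ := μ)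
          (K := RandomRate.Jbar W Z μ θs)
      exact ⟨Xc, P, hP, fun _ _ a => isEmptyElim a, hgauss, fun a => isEmptyElim a,
        fun a => isEmptyElim a, hlim⟩
  · have h := hmodel.convexScaleModel hLD hW
    have hJ := h.Jbar_eq hmgf hθs
    -- The remainder r is defined by solving the expansion for it, so the identity is algebra and
    -- the content lies in the estimate of r.
    refine ⟨?_, ?_, ⟨fun n ω a => n * (RandomRate.empRate W Z μ n ω a - RandomRate.rate W Z μ a
      + 1 / √(n : ℝ) * RandomRate.X W Z μ n ω (RandomRate.saddle W Z μ a)), ?_, ?_⟩,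
      h.exists_isGaussianProcess_tendsto_X hθs hJ hCov⟩
    · intro a ha
      rw [hJ] at ha
      have hs := h.deriv_g_saddle_of_mem hθs ha
      exact ⟨_, hs, fun θ hθ => h.strictMono_deriv_g.injective (hθ.trans hs.symm)⟩
    · rw [hJ]
      exact h.ae_eventually_existsUnique hθs
    · intro n hn ω a _
      have : (n : ℝ) ≠ 0 := by positivity
      field_simp
      ring
    · intro ε hε
      rw [hJ]
      exact h.tendsto_measure_expansion hθs (h.exists_bound_deriv_X hθs hJ hCov) hε
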